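/- **Theorem (moment bounds for the projected Euler scheme).** Let $b:\mathbb R^d\times\mathcal P_2(\mathbb R^d)\to\mathbb R^d$ and $\sigma:\mathbb R^d\times\mathcal P_2(\mathbb R^d)\to\mathbb R^{d\times m}$, where $\mathcal P_2(\mathbb R^d)$ is the set of Borel probability measures on $\mathbb R^d$ with finite second moment, $\mathcal W_2(\mu,\nu)$ is the $L^2$-Wasserstein distance, $\mathcal W_2(\mu)=(\int|x|^2\mu(dx))^{1/2}$, and $\|B\|=\sqrt{\operatorname{trace}(BB^T)}$. Assume that there are constants $K_1>K_2\ge 0$, $L_1,L_2>0$, $\kappa\ge 1$, $q_0\ge 20$, $a_1>a_2\ge 0$, $q^*\ge 4q_0-2$, $C\ge 0$ such that, for all $x,y\in\mathbb R^d$ and $\mu,\nu\in\mathcal P_2(\mathbb R^d)$, 1. $2\langle x-y,\,b(x,\mu)-b(y,\nu)\rangle+\|\sigma(x,\mu)-\sigma(y,\nu)\|^2\le -K_1|x-y|^2+K_2\mathcal W_2(\mu,\nu)^2$; 2. $|b(x,\mu)-b(y,\nu)|^2\le L_1\left[(1+|x|^{2\kappa-2}+|y|^{2\kappa-2})|x-y|^2+\mathcal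 W_2(\mu,\nu)^2\right]$; 3. $|b(0,\delta_0)|\le L_2$, and the initial value $X_0$ satisfies $\mathbb E|X_0|^{2q_0}<\infty$; 4. $2\langle x,b(x,\mu)\rangle+(q^*-1)\|\sigma(x,\mu)\|^2\le -a_1|x|^2+a_2\mathcal W_2(\mu)^2+C$. Let $0<h_0\le 1$, let $p$ be a real number with $1\le p<\lfloor q_0/2\rfloor$, and put $$h_2=\min\left\{\frac1{2(K_1-K_2)},\;h_0,\;\frac1{p(a_1-a_2)}\right\}.$$ Then there is a constant $K_6>0$, depending on $b$, $\sigma$, $p$ and the constants above but not on $h$, $k$, $N$, nor on $X_0$ or the probability space, with the following property. Let $W$ be an $m$-dimensional Wiener process and $X_0$ an $\mathbb R^d$-valued random variable independent of $W$ with $\mathbb E|X_0|^{2q_0}<\infty$. Let $N\ge 1$, let $(W^j,X_0^j)$, $1\le j\le N$, be independent and identically distributed copies of $(W,X_0)$ on the same probability space, and let $0<h\le h_2$. Put $\psi(x)=\min\{1,h^{-1/(2(\kappa+2))}|x|^{-1}\}\,x$ (with $\psi(0)=0$), and define the projected Euler iterates by $Y^{j,N}_0=X^j_0$ and, for $k\ge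 0$, $$\bar Y^{j,N}_k=\psi(Y^{j,N}_k),\qquad Y^{j,N}_{k+1}=\bar Y^{j,N}_k+h\,b\big(\bar Y^{j,N}_k,\mu_k\big)+\sigma\big(\bar Y^{j,N}_k,\mu_k\big)\big(W^j_{(k+1)h}-W^j_{kh}\big),\qquad \mu_k=\frac1N\sum_{i=1}^N\delta_{\bar Y^{i,N}_k}.$$ Then, for every $k\ge 0$, all the expectations below are finite and $$\sup_{1\le j\le N}\mathbb E\big[|Y^{j,N}_k|^{2p}\big]\;\le\;K_6\sup_{1\le j\le N}\mathbb E\big[1+|X^j_0|^{4p}\big]\;=\;K_6\,\mathbb E\big[1+|X_0|^{4p}\big].$$ -/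

import Mathlib

open MeasureTheory ProbabilityTheory
open scoped ENNReal NNReal

/-- Euclidean space `ℝ^d`. -/
abbrev Vec (d : ℕ) : Type := EuclideanSpace ℝ (Fin d)

/-- `𝒫₂(ℝ^d)`: Borel probability measures on `ℝ^d` with finite second moment. -/
def P2 (d : ℕ) : Type :=
  {μ : ProbabilityMeasure (Vec d) // ∫⁻ x, ‖x‖ₑ ^ 2 ∂(μ : Measure (Vec d)) < ∞}

namespace P2

variable {d : ℕ}

/-- The underlying measure. -/
noncomputable def toMeasure (μ : P2 d) : Measure (Vec d) := (μ.1 : Measure (Vec d))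

/-- `𝒲₂(μ) = (∫ |x|² μ(dx))^{1/2}`. -/
noncomputable def norm2 (μ : P2 d) : ℝ := √(∫ x, ‖x‖ ^ 2 ∂μ.toMeasure)

/-- The couplings of two measures: measures on the product with the given marginals. -/
def couplings (μ ν : P2 d) : Set (Measure (Vec d × Vec d)) :=
  {π | π.map Prod.fst = μ.toMeasure ∧ π.map Prod.snd = ν.toMeasure}

/-- The `L²`-Wasserstein distance: the square root of the least quadratic transport cost. -/
noncomputable def W2 (μ ν : P2 d) : ℝ :=
  √(⨅ π ∈ couplings μ ν, ∫⁻ z, ‖z.1 - z.2‖ₑ ^ 2 ∂π).toReal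

/-- The Dirac measure at `x`. -/
noncomputable def dirac (x : Vec d) : P2 d :=
  ⟨⟨Measure.dirac x, inferInstance⟩, by
    simp only [ProbabilityMeasure.coe_mk, lintegral_dirac]
    exact ENNReal.pow_lt_top enorm_lt_top⟩

/-- The empirical measure `(1/N) ∑ i, δ_{x i}`. -/
noncomputable def empirical {N : ℕ} [NeZero N] (x : Fin N → Vec d) : P2 d :=
  ⟨⟨(N : ℝ≥0∞)⁻¹ • ∑ i, Measure.dirac (x i), ⟨by
      simp [ENNReal.inv_mul_cancel (Nat.cast_ne_zero.2 (NeZero.ne N)) (ENNReal.natCast_ne_top N)]⟩⟩,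
    by
      simp only [ProbabilityMeasure.coe_mk, lintegral_smul_measure, lintegral_finsetSum_measure,
        lintegral_dirac, smul_eq_mul]
      refine ENNReal.mul_lt_top (ENNReal.inv_lt_top.2 ?_) (ENNReal.sum_lt_top.2 fun i _ => ?_)
      · exact_mod_cast Nat.pos_of_ne_zero (NeZero.ne N)
      · exact ENNReal.pow_lt_top enorm_lt_top⟩

end P2

/-- The Hilbert-Schmidt norm `√(trace (B Bᵀ))`. -/
noncomputable def hsNorm {d m : ℕ} (B : Matrix (Fin d) (Fin m) ℝ) : ℝ :=
  √(Matrix.trace (B * B.transpose))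

/-- Contractive monotonicity of the coefficients, with constants `K₁ > K₂ ≥ 0`. -/
structure ContractiveMonotone {d m : ℕ} (b : Vec d → P2 d → Vec d)
    (σ : Vec d → P2 d → Matrix (Fin d) (Fin m) ℝ) (K₁ K₂ : ℝ) : Prop where
  nonneg : 0 ≤ K₂
  lt : K₂ < K₁
  bound : ∀ (x y : Vec d) (μ ν : P2 d),
    2 * inner ℝ (x - y) (b x μ - b y ν) + hsNorm (σ x μ - σ y ν) ^ 2
      ≤ -K₁ * ‖x - y‖ ^ 2 + K₂ * P2.W2 μ ν ^ 2

/-- Polynomial growth Lipschitz condition on the drift, with constants `L₁ > 0`, `κ ≥ 1`. -/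
structure PolyLipschitz {d : ℕ} (b : Vec d → P2 d → Vec d) (L₁ κ : ℝ) : Prop where
  pos : 0 < L₁
  one_le : 1 ≤ κ
  bound : ∀ (x y : Vec d) (μ ν : P2 d),
    ‖b x μ - b y ν‖ ^ 2
      ≤ L₁ * ((1 + ‖x‖ ^ (2 * κ - 2) + ‖y‖ ^ (2 * κ - 2)) * ‖x - y‖ ^ 2 + P2.W2 μ ν ^ 2)

/-- Coercivity of the coefficients, with constants `a₁ > a₂ ≥ 0`, `q* ≥ 4 q₀ - 2`, `C ≥ 0`. -/
structure Coercive {d m : ℕ} (b : Vec d → P2 d → Vec d)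
    (σ : Vec d → P2 d → Matrix (Fin d) (Fin m) ℝ) (q₀ a₁ a₂ qs C : ℝ) : Prop where
  nonneg : 0 ≤ a₂
  lt : a₂ < a₁
  le_qs : 4 * q₀ - 2 ≤ qs
  C_nonneg : 0 ≤ C
  bound : ∀ (x : Vec d) (μ : P2 d),
    2 * inner ℝ x (b x μ) + (qs - 1) * hsNorm (σ x μ) ^ 2
      ≤ -a₁ * ‖x‖ ^ 2 + a₂ * P2.norm2 μ ^ 2 + C

/-- An `m`-dimensional Wiener process: its coordinates are independent standard real
Brownian motions (in particular with almost surely continuous paths). -/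
structure IsWiener {Ω : Type*} [MeasurableSpace Ω] {m : ℕ}
    (W : ℝ≥0 → Ω → Vec m) (P : Measure Ω) : Prop where
  measurable : ∀ t, Measurable (W t)
  brownian : ∀ i : Fin m, IsBrownianReal (fun t ω => W t ω i) P
  indep : iIndepFun (fun (i : Fin m) ω (t : ℝ≥0) => W t ω i) P

/-- `(Wc j, Xc j)`, `j : Fin N`, are independent and identically distributed copies of the
pair `(W, X)` consisting of a Wiener process and a random vector. -/
structure IsIIDCopies {Ω : Type*} [MeasurableSpace Ω] {d m N : ℕ}
    (W : ℝ≥0 → Ω → Vec m) (X : Ω → Vec d)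
    (Wc : Fin N → ℝ≥0 → Ω → Vec m) (Xc : Fin N → Ω → Vec d) (P : Measure Ω) : Prop where
  wiener : ∀ j, IsWiener (Wc j) P
  measurable : ∀ j, Measurable (Xc j)
  indep : iIndepFun (fun j ω => ((fun t : ℝ≥0 => Wc j t ω), Xc j ω)) P
  ident : ∀ j, IdentDistrib (fun ω => ((fun t : ℝ≥0 => Wc j t ω), Xc j ω))
    (fun ω => ((fun t : ℝ≥0 => W t ω), X ω)) P P

/-- The projection `ψ(x) = min {1, h^{-1/(2(κ+2))} |x|⁻¹} x`
(so `ψ(0) = 0`, whatever value the factor takes there). -/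
noncomputable def proj {d : ℕ} (κ h : ℝ) (x : Vec d) : Vec d :=
  min 1 (h ^ (-(1 / (2 * (κ + 2)))) * ‖x‖⁻¹) • x

/-- The projected Euler iterates `Y k j` of the `N`-particle system with step size `h`:
`Y 0 j = X j`, and, with `Ȳ i = ψ (Y k i)`,
`Y (k+1) j = Ȳ j + h b(Ȳ j, μ) + σ(Ȳ j, μ) (W j ((k+1)h) - W j (kh))`, where `μ` is the
empirical measure of the `Ȳ i`. -/
noncomputable def projectedEuler {Ω : Type*} {d m N : ℕ} [NeZero N]
    (b : Vec d → P2 d → Vec d) (σ : Vec d → P2 d → Matrix (Fin d) (Fin m) ℝ)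
    (κ : ℝ) (h : ℝ≥0) (W : Fin N → ℝ≥0 → Ω → Vec m) (X : Fin N → Ω → Vec d) :
    ℕ → Fin N → Ω → Vec d
  | 0, j, ω => X j ω
  | k + 1, j, ω =>
    let Yb : Fin N → Vec d := fun i => proj κ h (projectedEuler b σ κ h W X k i ω)
    let μ : P2 d := P2.empirical Yb
    Yb j + (h : ℝ) • b (Yb j) μ
      + WithLp.toLp 2 (Matrix.mulVec (σ (Yb j) μ)
          (W j (((k + 1 : ℕ) : ℝ≥0) * h) ω - W j ((k : ℝ≥0) * h) ω).ofLp)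

/-!
The proof is a Lyapunov argument for the even moments `E (1 + |ψ(Y_k)|²) ^ n`, where `n ≥ 2` is an
integer with `p ≤ n ≤ 2 p` and `n ≤ q₀ / 2`.

One step from a deterministic projected configuration `y` adds to `u = 1 + |y_j|²` an increment
`δ`, and `(u + δ) ^ n` is at most `u ^ n + n u ^ (n - 1) δ` plus a multiple of
`u ^ (n - 2) δ ^ 2 + u ^ (-n) δ ^ (2 n)` (`add_pow_le_expansion`). On the projection ball
`|y_i| ≤ h ^ (-1 / (2 (κ + 2)))` polynomial growth gives `h (1 + |y_j|²) |b|² = O(1)`, and then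
coercivity gives `h ‖σ‖⁴ = O(1)` (`exists_coefficient_bound`). So, after taking expectations, every
term is `O(h u ^ (n - 1))` except the first-order ones and the multiple `n (1 + 6 n) h ‖σ‖²` of
`u ^ (n - 1)`. As `1 + 6 n ≤ q* - 1`, the coercivity condition bounds these, and with Young's
inequality (`exists_integral_euler_step_le`)

  `E (1 + |Y'_j|²) ^ n ≤ (1 - a₁ h) u_j ^ n + h (a₂ N⁻¹ ∑ i, u_i ^ n + c)`.

The driving increments are independent of the past of all particles
(`IsIIDCopies.indepFun_past_increment`), so this bound can be integrated over the law of the current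
configuration (`integral_comp_le_of_indepFun`). Averaged over `j`, it is a recursion contracting at
rate `a₁ - a₂ > 0`, which bounds the average uniformly in `k`, `h ≤ 1` and `N`. Inserted back, the
average makes the recursion for each single `j` contract at rate `a₁`
(`interacting_recursion_le`); exchangeability of the particles is not needed.

Monotonicity enters only through the continuity of `σ`, which together with the continuity of `b`
makes the iterates measurable.
-/

/-! ### Empirical measures and the Wasserstein distance -/

namespace P2

variable {d N : ℕ}

lemma sq_W2_le_of_mem_couplings {μ ν : P2 d} {π : Measure (Vec d × Vec d)}
    (hπ : π ∈ couplings μ ν) {r : ℝ} (hr : 0 ≤ r)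
    (h : ∫⁻ z, ‖z.1 - z.2‖ₑ ^ 2 ∂π ≤ ENNReal.ofReal r) : W2 μ ν ^ 2 ≤ r := by
  rw [W2, Real.sq_sqrt ENNReal.toReal_nonneg]
  exact ENNReal.toReal_le_of_le_ofReal hr ((iInf₂_le π hπ).trans h)

variable [NeZero N]

lemma natCast_inv_mul_sum_ofReal (f : Fin N → ℝ) (hf : ∀ i, 0 ≤ f i) :
    (N : ℝ≥0∞)⁻¹ * ∑ i, ENNReal.ofReal (f i) = ENNReal.ofReal ((N : ℝ)⁻¹ * ∑ i, f i) := by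
  have hN : (0 : ℝ) < N := Nat.cast_pos.2 (NeZero.pos N)
  rw [ENNReal.ofReal_mul (by positivity), ENNReal.ofReal_sum_of_nonneg fun i _ => hf i,
    ENNReal.ofReal_inv_of_pos hN, ENNReal.ofReal_natCast]

lemma enorm_sq_eq_ofReal (x : Vec d) : ‖x‖ₑ ^ 2 = ENNReal.ofReal (‖x‖ ^ 2) := by
  rw [← ofReal_norm, ENNReal.ofReal_pow (norm_nonneg _)]

lemma toMeasure_empirical (x : Fin N → Vec d) :
    (empirical x).toMeasure = (N : ℝ≥0∞)⁻¹ • ∑ i, Measure.dirac (x i) := rfl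

/-- Pairing the atoms with equal index is a coupling of two empirical measures. -/
lemma sq_W2_empirical_le (x y : Fin N → Vec d) :
    W2 (empirical x) (empirical y) ^ 2 ≤ (N : ℝ)⁻¹ * ∑ i, ‖x i - y i‖ ^ 2 := by
  refine sq_W2_le_of_mem_couplings
    (π := (N : ℝ≥0∞)⁻¹ • ∑ i, Measure.dirac (x i, y i)) ⟨?_, ?_⟩ (by positivity) ?_
  · rw [toMeasure_empirical, Measure.map_smul, Measure.map_finset_sum measurable_fst.aemeasurable]
    simp [Measure.map_dirac' measurable_fst]
  · rw [toMeasure_empirical, Measure.map_smul, Measure.map_finset_sum measurable_snd.aemeasurable]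
    simp [Measure.map_dirac' measurable_snd]
  · simp only [lintegral_smul_measure, lintegral_finsetSum_measure, lintegral_dirac, smul_eq_mul,
      enorm_sq_eq_ofReal]
    rw [natCast_inv_mul_sum_ofReal _ fun i => by positivity]

lemma empirical_zero : empirical (fun _ : Fin N => (0 : Vec d)) = dirac 0 := by
  apply Subtype.ext
  apply Subtype.ext
  change (N : ℝ≥0∞)⁻¹ • ∑ _i : Fin N, Measure.dirac (0 : Vec d) = Measure.dirac 0
  rw [Finset.sum_const, Finset.card_univ, Fintype.card_fin, ← Nat.cast_smul_eq_nsmul ℝ≥0∞,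
    smul_smul, ENNReal.inv_mul_cancel (Nat.cast_ne_zero.2 (NeZero.ne N))
      (ENNReal.natCast_ne_top N), one_smul]

lemma sq_W2_empirical_dirac_zero_le (x : Fin N → Vec d) :
    W2 (empirical x) (dirac 0) ^ 2 ≤ (N : ℝ)⁻¹ * ∑ i, ‖x i‖ ^ 2 := by
  simpa [empirical_zero] using sq_W2_empirical_le x (fun _ => 0)

lemma sq_norm2_empirical (x : Fin N → Vec d) :
    norm2 (empirical x) ^ 2 = (N : ℝ)⁻¹ * ∑ i, ‖x i‖ ^ 2 := by
  rw [norm2, Real.sq_sqrt (integral_nonneg fun _ => by positivity), toMeasure_empirical,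
    integral_smul_measure, integral_finsetSum_measure]
  · simp
  · intro i _
    exact integrable_dirac (by simp)

end P2

lemma natCast_inv_mul_sum_le {N : ℕ} [NeZero N] {f : Fin N → ℝ} {r : ℝ} (h : ∀ i, f i ≤ r) :
    (N : ℝ)⁻¹ * ∑ i, f i ≤ r := by
  have hN : (0 : ℝ) < N := Nat.cast_pos.2 (NeZero.pos N)
  rw [inv_mul_le_iff₀ hN]
  simpa using Finset.sum_le_card_nsmul Finset.univ f r fun i _ => h i

/-! ### The Hilbert-Schmidt norm -/

section hsNorm

variable {d m : ℕ}

lemma hsNorm_nonneg (B : Matrix (Fin d) (Fin m) ℝ) : 0 ≤ hsNorm B := Real.sqrt_nonneg _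

lemma sq_hsNorm (B : Matrix (Fin d) (Fin m) ℝ) : hsNorm B ^ 2 = ∑ i, ∑ j, B i j ^ 2 := by
  have : Matrix.trace (B * B.transpose) = ∑ i, ∑ j, B i j ^ 2 := by
    simp [Matrix.trace, Matrix.mul_apply, sq]
  rw [hsNorm, this, Real.sq_sqrt (by positivity)]

lemma abs_apply_le_hsNorm (B : Matrix (Fin d) (Fin m) ℝ) (i : Fin d) (j : Fin m) :
    |B i j| ≤ hsNorm B := by
  refine abs_le_of_sq_le_sq ?_ (hsNorm_nonneg B)
  rw [sq_hsNorm]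
  exact (Finset.single_le_sum (f := fun j => B i j ^ 2) (fun j _ => sq_nonneg _)
    (Finset.mem_univ j)).trans (Finset.single_le_sum (f := fun i => ∑ j, B i j ^ 2)
    (fun i _ => by positivity) (Finset.mem_univ i))

lemma sq_norm_mulVec (B : Matrix (Fin d) (Fin m) ℝ) (g : Vec m) :
    ‖WithLp.toLp 2 (B.mulVec g.ofLp)‖ ^ 2 = ∑ i, (∑ j, B i j * g j) ^ 2 := by
  simp [EuclideanSpace.real_norm_sq_eq, Matrix.mulVec, dotProduct]

lemma sq_norm_mulVec_le (B : Matrix (Fin d) (Fin m) ℝ) (g : Vec m) :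
    ‖WithLp.toLp 2 (B.mulVec g.ofLp)‖ ^ 2 ≤ hsNorm B ^ 2 * ‖g‖ ^ 2 := by
  rw [sq_norm_mulVec, sq_hsNorm, EuclideanSpace.real_norm_sq_eq, Finset.sum_mul]
  exact Finset.sum_le_sum fun i _ => Finset.sum_mul_sq_le_sq_mul_sq _ _ _

end hsNorm

/-! ### Continuity of the coefficients along empirical measures -/

section Continuity

variable {d m N : ℕ} [NeZero N] {b : Vec d → P2 d → Vec d}
  {σ : Vec d → P2 d → Matrix (Fin d) (Fin m) ℝ} {K₁ K₂ L₁ κ : ℝ}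

lemma PolyLipschitz.continuous_drift (hlip : PolyLipschitz b L₁ κ) (j : Fin N) :
    Continuous fun y : Fin N → Vec d => b (y j) (P2.empirical y) := by
  rw [continuous_iff_continuousAt]
  intro y
  have hκ : 0 ≤ 2 * κ - 2 := by linarith [hlip.one_le]
  set g : (Fin N → Vec d) → ℝ := fun x =>
    L₁ * ((1 + ‖x j‖ ^ (2 * κ - 2) + ‖y j‖ ^ (2 * κ - 2)) * ‖x j - y j‖ ^ 2
      + (N : ℝ)⁻¹ * ∑ i, ‖x i - y i‖ ^ 2) with hg
  have hgc : Continuous g := by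
    have h1 : Continuous fun x : Fin N → Vec d => ‖x j‖ ^ (2 * κ - 2) :=
      (continuous_apply j).norm.rpow_const fun _ => Or.inr hκ
    fun_prop
  have h0 : Filter.Tendsto (fun x => √(g x)) (nhds y) (nhds 0) := by
    have := (hgc.sqrt).tendsto y
    simpa [hg] using this
  refine tendsto_iff_norm_sub_tendsto_zero.2
    (squeeze_zero (fun _ => norm_nonneg _) (fun x => ?_) h0)
  refine Real.le_sqrt_of_sq_le ((hlip.bound _ _ _ _).trans ?_)
  have := hlip.pos
  have := P2.sq_W2_empirical_le x y
  simp only [hg]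
  gcongr

lemma ContractiveMonotone.continuous_diffusion (hmono : ContractiveMonotone b σ K₁ K₂)
    (hlip : PolyLipschitz b L₁ κ) (j : Fin N) :
    Continuous fun y : Fin N → Vec d => σ (y j) (P2.empirical y) := by
  refine continuous_pi fun i => continuous_pi fun l => ?_
  rw [continuous_iff_continuousAt]
  intro y
  set g : (Fin N → Vec d) → ℝ := fun x =>
    |K₁| * ‖x j - y j‖ ^ 2 + K₂ * ((N : ℝ)⁻¹ * ∑ i, ‖x i - y i‖ ^ 2)
      + 2 * (‖x j - y j‖ * ‖b (x j) (P2.empirical x) - b (y j) (P2.empirical y)‖) with hg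
  have hgc : Continuous g := by
    have h1 : Continuous fun x : Fin N → Vec d =>
        ‖b (x j) (P2.empirical x) - b (y j) (P2.empirical y)‖ :=
      ((hlip.continuous_drift j).sub continuous_const).norm
    exact .add (by fun_prop) (continuous_const.mul (.mul (by fun_prop) h1))
  have h0 : Filter.Tendsto (fun x => √(g x)) (nhds y) (nhds 0) := by
    have := (hgc.sqrt).tendsto y
    simpa [hg] using this
  refine tendsto_iff_norm_sub_tendsto_zero.2
    (squeeze_zero (fun _ => norm_nonneg _) (fun x => ?_) h0)
  rw [Real.norm_eq_abs]
  refine (abs_apply_le_hsNorm (σ (x j) (P2.empirical x) - σ (y j) (P2.empirical y)) i l).trans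
    (Real.le_sqrt_of_sq_le ?_)
  have h1 := hmono.bound (x j) (y j) (P2.empirical x) (P2.empirical y)
  have h2 := mul_le_mul_of_nonneg_left (P2.sq_W2_empirical_le x y) hmono.nonneg
  have h3 := neg_le_of_abs_le
    (abs_real_inner_le_norm (x j - y j) (b (x j) (P2.empirical x) - b (y j) (P2.empirical y)))
  have h4 := mul_le_mul_of_nonneg_right (neg_abs_le K₁) (sq_nonneg ‖x j - y j‖)
  have h5 := mul_le_mul_of_nonneg_right (neg_le_abs K₁) (sq_nonneg ‖x j - y j‖)
  simp only [hg]
  linarith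

end Continuity

/-! ### The one-step expansion of even moments -/

/-- The second-order bound near `0` comes from `(1 + t) ^ n ≤ exp (n t)`; away from `0`
the last term dominates. -/
lemma one_add_pow_le {n : ℕ} (hn : 1 ≤ n) {t : ℝ} (ht : -1 ≤ t) :
    (1 + t) ^ n ≤ 1 + n * t + (n : ℝ) ^ 2 * t ^ 2 + ((n : ℝ) ^ 2 + n) ^ n * t ^ (2 * n) := by
  have hn' : (1 : ℝ) ≤ n := by exact_mod_cast hn
  have hlast : 0 ≤ ((n : ℝ) ^ 2 + n) ^ n * t ^ (2 * n) := by
    rw [pow_mul]; positivity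
  rcases le_total (|(n : ℝ) * t|) 1 with h | h
  · have h1 : (1 + t) ^ n ≤ Real.exp (n * t) := by
      rw [Real.exp_nat_mul]
      exact pow_le_pow_left₀ (by linarith) (by linarith [Real.add_one_le_exp t]) n
    have h2 := (abs_le.1 (Real.abs_exp_sub_one_sub_id_le h)).2
    nlinarith
  · rw [abs_mul, Nat.abs_cast] at h
    have h1 : (1 + t) ^ n ≤ ((n : ℝ) ^ 2 + n) ^ n * t ^ (2 * n) := by
      rw [pow_mul, ← mul_pow, ← sq_abs t]
      refine pow_le_pow_left₀ (by linarith) ?_ n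
      have := le_abs_self t
      nlinarith [abs_nonneg t, mul_le_mul_of_nonneg_right h (abs_nonneg t)]
    have h2 : 0 ≤ 1 + n * t + (n : ℝ) ^ 2 * t ^ 2 := by
      nlinarith [sq_nonneg ((n : ℝ) * t + 1 / 2)]
    linarith

lemma add_pow_le_expansion {n : ℕ} (hn : 2 ≤ n) {u δ : ℝ} (hu : 1 ≤ u) (hδ : 0 ≤ u + δ) :
    (u + δ) ^ n ≤ u ^ n + n * u ^ (n - 1) * δ + (n : ℝ) ^ 2 * u ^ (n - 2) * δ ^ 2
      + ((n : ℝ) ^ 2 + n) ^ n * (δ ^ 2 / u) ^ n := by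
  obtain ⟨k, rfl⟩ := Nat.exists_eq_add_of_le hn
  have hu0 : 0 < u := by linarith
  have h := one_add_pow_le (n := 2 + k) (by omega) (t := δ / u)
    (by rw [le_div_iff₀ hu0]; linarith)
  have h2 := mul_le_mul_of_nonneg_left h (pow_nonneg hu0.le (2 + k))
  rw [← mul_pow, mul_add, mul_div_cancel₀ _ hu0.ne', mul_one] at h2
  refine h2.trans (le_of_eq ?_)
  have e1 : 2 + k - 1 = k + 1 := by omega
  have e2 : 2 + k - 2 = k := by omega
  rw [e1, e2, pow_mul]
  have e3 : u ^ (2 + k) * ((δ / u) ^ 2) ^ (2 + k) = (δ ^ 2 / u) ^ (2 + k) := by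
    rw [← mul_pow]; congr 1; field_simp
  have e4 : u ^ (2 + k) * (δ / u) ^ 2 = u ^ k * δ ^ 2 := by
    rw [pow_add]; field_simp
  have e5 : u ^ (2 + k) * (δ / u) = u ^ (k + 1) * δ := by
    rw [show 2 + k = (k + 1) + 1 by ring, pow_succ u (k + 1)]; field_simp
  linear_combination (↑(2 + k) : ℝ) * e5 + (↑(2 + k) : ℝ) ^ 2 * e4
    + ((↑(2 + k) : ℝ) ^ 2 + ↑(2 + k)) ^ (2 + k) * e3

lemma add_four_pow_le (n : ℕ) {w x y z : ℝ} (hw : 0 ≤ w) (hx : 0 ≤ x) (hy : 0 ≤ y) (hz : 0 ≤ z) :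
    (w + x + y + z) ^ n ≤ 4 ^ n * (w ^ n + x ^ n + y ^ n + z ^ n) := by
  obtain ⟨M, hM, hM0, hle⟩ : ∃ M, M ^ n ≤ w ^ n + x ^ n + y ^ n + z ^ n ∧ 0 ≤ M ∧
      w + x + y + z ≤ 4 * M := by
    have hwn := pow_nonneg hw n
    have hxn := pow_nonneg hx n
    have hyn := pow_nonneg hy n
    have hzn := pow_nonneg hz n
    rcases le_total w x with h1 | h1 <;> rcases le_total y z with h2 | h2
    · rcases le_total x z with h3 | h3
      · exact ⟨z, by linarith, hz, by linarith⟩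
      · exact ⟨x, by linarith, hx, by linarith⟩
    · rcases le_total x y with h3 | h3
      · exact ⟨y, by linarith, hy, by linarith⟩
      · exact ⟨x, by linarith, hx, by linarith⟩
    · rcases le_total w z with h3 | h3
      · exact ⟨z, by linarith, hz, by linarith⟩
      · exact ⟨w, by linarith, hw, by linarith⟩
    · rcases le_total w y with h3 | h3
      · exact ⟨y, by linarith, hy, by linarith⟩
      · exact ⟨w, by linarith, hw, by linarith⟩
  calc (w + x + y + z) ^ n ≤ (4 * M) ^ n := pow_le_pow_left₀ (by positivity) hle n
    _ = 4 ^ n * M ^ n := mul_pow _ _ _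
    _ ≤ _ := by gcongr

/-- The quadratic remainder, with the noise split off as `ρ`: the factor `6` leaves room between
the sharp factor `4` and what coercivity can absorb. -/
lemma sq_add_le_of_sq_le {u Z D ρ τ : ℝ} (hρ : ρ ^ 2 ≤ 4 * (u * Z))
    (hτ : τ ^ 2 ≤ 12 * (2 * D + Z ^ 2)) :
    (ρ + τ) ^ 2 ≤ 6 * (u * Z) + 36 * (2 * D + Z ^ 2) := by
  nlinarith [sq_nonneg (ρ - 2 * τ)]

/-- The top-order remainder is of order `h + Z ^ n + Z ^ (2 n)`, uniformly in `u`. -/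
lemma sq_add_div_pow_le {n : ℕ} (hn : 2 ≤ n) {A h u Z β ρ τ : ℝ} (hA : 1 ≤ A) (hh : 0 < h)
    (hh1 : h ≤ 1) (hu : 1 ≤ u) (hZ : 0 ≤ Z) (hβ : 0 ≤ β) (huβ : u * β ≤ A * h)
    (hρ : ρ ^ 2 ≤ 4 * (u * Z)) (hτ : τ ^ 2 ≤ 12 * (u * β + β ^ 2 + Z ^ 2)) :
    ((ρ + τ) ^ 2 / u) ^ n ≤ 4 ^ n * 24 ^ n * (2 * A ^ (2 * n) * h + Z ^ n + Z ^ (2 * n)) := by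
  have hu0 : 0 < u := by linarith
  have hβA : β ≤ A * h := by nlinarith
  have h1 : (ρ + τ) ^ 2 / u ≤ 24 * Z + 24 * (A * h) + 24 * (A * h) ^ 2 + 24 * Z ^ 2 := by
    have h2 : (ρ + τ) ^ 2 ≤ 2 * ρ ^ 2 + 2 * τ ^ 2 := by
      linarith [sq_nonneg (ρ - τ), add_sq ρ τ, sub_sq ρ τ]
    have h3 : β ^ 2 ≤ (A * h) ^ 2 := by gcongr
    have h4 : 24 * (A * h) + 24 * (A * h) ^ 2 + 24 * Z ^ 2
        ≤ (24 * (A * h) + 24 * (A * h) ^ 2 + 24 * Z ^ 2) * u :=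
      le_mul_of_one_le_right (by positivity) hu
    have h5 : 0 ≤ u * Z := by positivity
    rw [div_le_iff₀ hu0]
    linarith
  have h2 : (A * h) ^ n ≤ A ^ (2 * n) * h := by
    rw [mul_pow]
    exact mul_le_mul (pow_le_pow_right₀ hA (by omega))
      (pow_le_of_le_one hh.le hh1 (by omega)) (by positivity) (by positivity)
  have h3 : ((A * h) ^ 2) ^ n ≤ A ^ (2 * n) * h := by
    rw [← pow_mul, mul_pow]
    exact mul_le_mul_of_nonneg_left (pow_le_of_le_one hh.le hh1 (by omega)) (by positivity)
  calc ((ρ + τ) ^ 2 / u) ^ n ≤ (24 * Z + 24 * (A * h) + 24 * (A * h) ^ 2 + 24 * Z ^ 2) ^ n :=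
        pow_le_pow_left₀ (by positivity) h1 n
    _ ≤ 4 ^ n * ((24 * Z) ^ n + (24 * (A * h)) ^ n + (24 * (A * h) ^ 2) ^ n + (24 * Z ^ 2) ^ n) :=
        add_four_pow_le n (by positivity) (by positivity) (by positivity) (by positivity)
    _ = 4 ^ n * 24 ^ n * (((A * h) ^ n + ((A * h) ^ 2) ^ n) + Z ^ n + Z ^ (2 * n)) := by
        simp only [pow_mul Z 2 n]; ring
    _ ≤ _ := by gcongr; linarith

lemma sq_two_mul_inner_le {E : Type*} [NormedAddCommGroup E] [InnerProductSpace ℝ E] (y z : E) :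
    (2 * inner ℝ y z) ^ 2 ≤ 4 * ((1 + ‖y‖ ^ 2) * ‖z‖ ^ 2) := by
  have h1 := sq_le_sq' (neg_le_of_abs_le (abs_real_inner_le_norm y z))
    (le_of_abs_le (abs_real_inner_le_norm y z))
  rw [mul_pow] at h1
  rw [mul_pow, one_add_mul]
  linarith [sq_nonneg ‖z‖]

lemma sq_remainder_le {E : Type*} [NormedAddCommGroup E] [InnerProductSpace ℝ E] (y b z : E)
    {h : ℝ} (hh : 0 < h) :
    (2 * h * inner ℝ y b + h ^ 2 * ‖b‖ ^ 2 + 2 * (h * inner ℝ b z) + ‖z‖ ^ 2) ^ 2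
      ≤ 12 * ((1 + ‖y‖ ^ 2) * (h ^ 2 * ‖b‖ ^ 2) + (h ^ 2 * ‖b‖ ^ 2) ^ 2 + (‖z‖ ^ 2) ^ 2) := by
  have h2 : (2 * h * inner ℝ y b) ^ 2 ≤ 4 * ((1 + ‖y‖ ^ 2) * (h ^ 2 * ‖b‖ ^ 2)) := by
    have := mul_le_mul_of_nonneg_left (sq_two_mul_inner_le y b) (sq_nonneg h)
    calc (2 * h * inner ℝ y b) ^ 2 = h ^ 2 * (2 * inner ℝ y b) ^ 2 := by ring
      _ ≤ _ := this.trans (le_of_eq (by ring))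
  have h4 : |2 * (h * inner ℝ b z)| ≤ h ^ 2 * ‖b‖ ^ 2 + ‖z‖ ^ 2 := by
    have h5 : h * |inner ℝ b z| ≤ h * (‖b‖ * ‖z‖) := by
      gcongr; exact abs_real_inner_le_norm b z
    rw [abs_mul, abs_mul, abs_of_pos hh, abs_two]
    linarith [sq_nonneg (h * ‖b‖ - ‖z‖), sub_sq (h * ‖b‖) ‖z‖, mul_pow h ‖b‖ 2]
  generalize 2 * h * inner ℝ y b = s at *
  generalize 2 * (h * inner ℝ b z) = w at *
  generalize hβ : h ^ 2 * ‖b‖ ^ 2 = β at *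
  generalize ‖z‖ ^ 2 = Z at *
  obtain ⟨h6, h7⟩ := abs_le.1 h4
  have h8 : (β + w + Z) ^ 2 ≤ (2 * (β + Z)) ^ 2 := sq_le_sq' (by linarith) (by linarith)
  have h9 : (s + β + w + Z) ^ 2 ≤ 3 * s ^ 2 + 3 / 2 * (β + w + Z) ^ 2 := by
    linarith [sq_nonneg (2 * s - (β + w + Z)), add_sq s (β + w + Z),
      sub_sq (2 * s) (β + w + Z), mul_pow 2 s 2,
      congrArg (· ^ 2) (show s + β + w + Z = s + (β + w + Z) by ring)]
  have h10 : (2 * (β + Z)) ^ 2 ≤ 8 * (β ^ 2 + Z ^ 2) := by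
    linarith [sq_nonneg (β - Z), add_sq β Z, sub_sq β Z, mul_pow 2 (β + Z) 2]
  linarith

lemma remainder_terms_le {n : ℕ} (hn : 2 ≤ n) {A h u Z δ : ℝ} (hA : 1 ≤ A) (hh : 0 < h)
    (hu : 1 ≤ u) (hZ : 0 ≤ Z) (hδ2 : δ ^ 2 ≤ 6 * (u * Z) + 36 * (2 * (A ^ 2 * h) + Z ^ 2))
    (hδn : (δ ^ 2 / u) ^ n ≤ 4 ^ n * 24 ^ n * (2 * A ^ (2 * n) * h + Z ^ n + Z ^ (2 * n))) :
    (n : ℝ) ^ 2 * u ^ (n - 2) * δ ^ 2 + ((n : ℝ) ^ 2 + n) ^ n * (δ ^ 2 / u) ^ n ≤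
      n * u ^ (n - 1) * (6 * n * Z +
        (72 * n * A ^ 2 + 36 * n + ((n : ℝ) ^ 2 + n) ^ n * (4 ^ n * 24 ^ n) * (2 * A ^ (2 * n))) *
          (h + Z ^ 2 + Z ^ n + Z ^ (2 * n))) := by
  have hn1 : (1 : ℝ) ≤ n := by exact_mod_cast (by omega : 1 ≤ n)
  have hun : 1 ≤ u ^ (n - 1) := one_le_pow₀ hu
  have hun2 : u ^ (n - 2) * u = u ^ (n - 1) := by rw [← pow_succ]; congr 1; omega
  have hun2' : u ^ (n - 2) ≤ u ^ (n - 1) := pow_le_pow_right₀ hu (by omega)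
  have hu0 : 0 ≤ u ^ (n - 2) := by positivity
  have hA2 : 1 ≤ A ^ (2 * n) := one_le_pow₀ hA
  have hZn : 0 ≤ Z ^ n := by positivity
  have hZ2n : 0 ≤ Z ^ (2 * n) := by positivity
  have hquad : (n : ℝ) ^ 2 * u ^ (n - 2) * δ ^ 2 ≤ n * u ^ (n - 1) *
      (6 * n * Z + 36 * n * (2 * (A ^ 2 * h) + Z ^ 2)) := by
    calc (n : ℝ) ^ 2 * u ^ (n - 2) * δ ^ 2
        ≤ (n : ℝ) ^ 2 * u ^ (n - 2) * (6 * (u * Z) + 36 * (2 * (A ^ 2 * h) + Z ^ 2)) := by gcongr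
      _ = (n : ℝ) ^ 2 * (6 * ((u ^ (n - 2) * u) * Z)
          + u ^ (n - 2) * (36 * (2 * (A ^ 2 * h) + Z ^ 2))) := by ring
      _ ≤ (n : ℝ) ^ 2 * (6 * ((u ^ (n - 2) * u) * Z)
          + u ^ (n - 1) * (36 * (2 * (A ^ 2 * h) + Z ^ 2))) := by gcongr
      _ = _ := by rw [hun2]; ring
  have hB : 0 ≤ ((n : ℝ) ^ 2 + n) ^ n * (4 ^ n * 24 ^ n) := by positivity
  have htop : ((n : ℝ) ^ 2 + n) ^ n * (δ ^ 2 / u) ^ n ≤ n * u ^ (n - 1) *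
      (((n : ℝ) ^ 2 + n) ^ n * (4 ^ n * 24 ^ n) *
        (2 * A ^ (2 * n) * (h + Z ^ 2 + Z ^ n + Z ^ (2 * n)))) := by
    have h1 : 2 * A ^ (2 * n) * h + Z ^ n + Z ^ (2 * n)
        ≤ 2 * A ^ (2 * n) * (h + Z ^ 2 + Z ^ n + Z ^ (2 * n)) := by
      have e : Z ^ n + Z ^ (2 * n) ≤ 2 * A ^ (2 * n) * (Z ^ n + Z ^ (2 * n)) :=
        le_mul_of_one_le_left (by positivity) (by linarith)
      have e' : 0 ≤ 2 * A ^ (2 * n) * Z ^ 2 := by positivity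
      linarith
    have h2 : 1 ≤ n * u ^ (n - 1) := one_le_mul_of_one_le_of_one_le hn1 hun
    have h3 := mul_le_mul_of_nonneg_left (hδn.trans
      (mul_le_mul_of_nonneg_left h1 (by positivity))) (by positivity : 0 ≤ ((n : ℝ) ^ 2 + n) ^ n)
    rw [← mul_assoc (((n : ℝ) ^ 2 + n) ^ n)] at h3
    exact h3.trans (le_mul_of_one_le_left (by positivity) h2)
  refine (add_le_add hquad htop).trans ?_
  rw [← mul_add]
  refine mul_le_mul_of_nonneg_left ?_ (by positivity)
  generalize ((n : ℝ) ^ 2 + n) ^ n * (4 ^ n * 24 ^ n) = B at hB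
  have e3 : 0 ≤ (72 * n * A ^ 2 + 36 * n) * (Z ^ n + Z ^ (2 * n)) := by positivity
  have e4 : 0 ≤ 72 * n * A ^ 2 * Z ^ 2 + 36 * n * h := by positivity
  linarith

/-- Pointwise expansion of `(1 + ‖y + h b + z‖²) ^ n` for a drift `b` that the projection has
tamed to `h (1 + ‖y‖²) ‖b‖² ≤ A`. The coefficient `1 + 6 n` of `‖z‖²` is the only constant whose
size matters: it has to stay below the coefficient of `‖σ‖²` in the coercivity condition. -/
lemma exists_one_add_sq_norm_pow_le {n : ℕ} (hn : 2 ≤ n) {A : ℝ} (hA : 1 ≤ A) :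
    ∃ c : ℝ, 0 ≤ c ∧ ∀ (E : Type) [NormedAddCommGroup E] [InnerProductSpace ℝ E] (y b z : E)
      (h : ℝ), 0 < h → h ≤ 1 → h * ((1 + ‖y‖ ^ 2) * ‖b‖ ^ 2) ≤ A →
      (1 + ‖y + h • b + z‖ ^ 2) ^ n ≤ (1 + ‖y‖ ^ 2) ^ n + n * (1 + ‖y‖ ^ 2) ^ (n - 1) *
        (2 * h * inner ℝ y b + 2 * inner ℝ (y + h • b) z + (1 + 6 * n) * ‖z‖ ^ 2
          + c * (h + (‖z‖ ^ 2) ^ 2 + (‖z‖ ^ 2) ^ n + (‖z‖ ^ 2) ^ (2 * n))) := by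
  refine ⟨A + (72 * n * A ^ 2 + 36 * n + ((n : ℝ) ^ 2 + n) ^ n * (4 ^ n * 24 ^ n) *
    (2 * A ^ (2 * n))), by positivity, ?_⟩
  intro E _ _ y b z h hh hh1 hyb
  set u : ℝ := 1 + ‖y‖ ^ 2 with hu
  have hu1 : 1 ≤ u := by rw [hu]; linarith [sq_nonneg ‖y‖]
  have hu0 : 0 < u := by linarith
  set Z : ℝ := ‖z‖ ^ 2 with hZ
  have hZ0 : 0 ≤ Z := sq_nonneg _
  set β : ℝ := h ^ 2 * ‖b‖ ^ 2 with hβ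
  have hβ0 : 0 ≤ β := by positivity
  have huβ : u * β ≤ A * h := by rw [hβ]; nlinarith
  have hβA : β ≤ A * h := by nlinarith
  have hAh : 0 ≤ A * h := by positivity
  set δ : ℝ := 2 * h * inner ℝ y b + β + 2 * inner ℝ (y + h • b) z + Z with hδ
  have hexp : 1 + ‖y + h • b + z‖ ^ 2 = u + δ := by
    rw [norm_add_sq_real, norm_add_sq_real, norm_smul, real_inner_smul_right, Real.norm_eq_abs,
      mul_pow, sq_abs]
    simp only [hu, hδ, hβ, hZ]; ring
  have hpos : 0 ≤ u + δ := by rw [← hexp]; positivity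
  -- Split `δ = ρ + τ` with the dominant noise term `ρ = 2 ⟪y, z⟫`.
  set ρ : ℝ := 2 * inner ℝ y z with hρ
  set τ : ℝ := 2 * h * inner ℝ y b + β + 2 * (h * inner ℝ b z) + Z with hτ
  have hsplit : δ = ρ + τ := by
    simp only [hδ, hρ, hτ, inner_add_left, real_inner_smul_left]; ring
  have hρ2 : ρ ^ 2 ≤ 4 * (u * Z) := sq_two_mul_inner_le y z
  have hτ2 : τ ^ 2 ≤ 12 * (u * β + β ^ 2 + Z ^ 2) := sq_remainder_le y b z hh
  have hβ2 : β ^ 2 ≤ A ^ 2 * h := by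
    have := mul_le_mul hβA hβA hβ0 hAh
    have := mul_le_of_le_one_right (by positivity : 0 ≤ A ^ 2 * h) hh1
    linarith
  have huβ2 : u * β ≤ A ^ 2 * h := by
    have := mul_le_mul_of_nonneg_right hA hAh
    linarith
  have hδ2 : δ ^ 2 ≤ 6 * (u * Z) + 36 * (2 * (A ^ 2 * h) + Z ^ 2) := by
    rw [hsplit]
    exact sq_add_le_of_sq_le hρ2 (by linarith)
  have hδn : (δ ^ 2 / u) ^ n ≤ 4 ^ n * 24 ^ n * (2 * A ^ (2 * n) * h + Z ^ n + Z ^ (2 * n)) := by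
    rw [hsplit]
    exact sq_add_div_pow_le hn hA hh hh1 hu1 hZ0 hβ0 huβ hρ2 hτ2
  have hmain := add_pow_le_expansion hn hu1 hpos
  rw [← hexp] at hmain
  have hrem := remainder_terms_le hn hA hh hu1 hZ0 hδ2 hδn
  generalize 72 * n * A ^ 2 + 36 * n + ((n : ℝ) ^ 2 + n) ^ n * (4 ^ n * 24 ^ n) *
    (2 * A ^ (2 * n)) = B at hrem ⊢
  have hS : 0 ≤ A * (Z ^ 2 + Z ^ n + Z ^ (2 * n)) := by positivity
  have hbracket : δ + (6 * n * Z + B * (h + Z ^ 2 + Z ^ n + Z ^ (2 * n))) ≤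
      2 * h * inner ℝ y b + 2 * inner ℝ (y + h • b) z + (1 + 6 * n) * Z
          + (A + B) * (h + Z ^ 2 + Z ^ n + Z ^ (2 * n)) := by
    rw [hδ]
    linarith
  have := mul_le_mul_of_nonneg_left hbracket (show 0 ≤ n * u ^ (n - 1) by positivity)
  linarith

/-! ### Tamed coefficients -/

section Projection

variable {d : ℕ} {κ h : ℝ}

lemma measurable_proj : Measurable (proj κ h : Vec d → Vec d) := by
  unfold proj
  fun_prop

lemma norm_proj_eq (hh : 0 ≤ h) (x : Vec d) :
    ‖proj κ h x‖ = min 1 (h ^ (-(1 / (2 * (κ + 2)))) * ‖x‖⁻¹) * ‖x‖ := by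
  rw [proj, norm_smul, Real.norm_eq_abs, abs_of_nonneg]
  have := Real.rpow_nonneg hh (-(1 / (2 * (κ + 2))))
  positivity

lemma norm_proj_le_norm (hh : 0 ≤ h) (x : Vec d) : ‖proj κ h x‖ ≤ ‖x‖ := by
  rw [norm_proj_eq hh]
  exact mul_le_of_le_one_left (norm_nonneg x) (min_le_left _ _)

lemma norm_proj_le_radius (hh : 0 ≤ h) (x : Vec d) :
    ‖proj κ h x‖ ≤ h ^ (-(1 / (2 * (κ + 2)))) := by
  have hR := Real.rpow_nonneg hh (-(1 / (2 * (κ + 2))))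
  rw [norm_proj_eq hh]
  refine (mul_le_mul_of_nonneg_right (min_le_right _ _) (norm_nonneg x)).trans ?_
  rw [mul_assoc]
  exact mul_le_of_le_one_right hR inv_mul_le_one

lemma one_le_radius (hκ : 1 ≤ κ) (hh : 0 < h) (hh1 : h ≤ 1) :
    1 ≤ h ^ (-(1 / (2 * (κ + 2)))) := by
  refine Real.one_le_rpow_of_pos_of_le_one_of_nonpos hh hh1 ?_
  have : 0 < 1 / (2 * (κ + 2)) := by positivity
  linarith

lemma radius_rpow (hκ : 1 ≤ κ) (hh : 0 < h) :
    (h ^ (-(1 / (2 * (κ + 2))))) ^ (2 * κ - 2) * (h ^ (-(1 / (2 * (κ + 2))))) ^ 6 = h⁻¹ := by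
  rw [← Real.rpow_natCast, ← Real.rpow_add (Real.rpow_pos_of_pos hh _), ← Real.rpow_mul hh.le,
    ← Real.rpow_neg_one]
  congr 1
  push_cast
  field_simp
  ring

end Projection

/-- On a ball of radius `R ≥ 1` the drift and the diffusion have polynomial growth, with the
exponent `2 κ + 4` that the projection radius turns into `h⁻¹`. The bound on the diffusion
follows from coercivity and the bound on the drift. -/
lemma exists_coefficient_bound {d m : ℕ} {b : Vec d → P2 d → Vec d}
    {σ : Vec d → P2 d → Matrix (Fin d) (Fin m) ℝ} {L₁ κ q₀ a₁ a₂ qs C : ℝ}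
    (hlip : PolyLipschitz b L₁ κ) (hcoer : Coercive b σ q₀ a₁ a₂ qs C) (hqs : 2 ≤ qs) :
    ∃ A : ℝ, 1 ≤ A ∧ ∀ (N : ℕ) [NeZero N] (y : Fin N → Vec d) (R : ℝ), 1 ≤ R →
      (∀ i, ‖y i‖ ≤ R) → ∀ j,
      (1 + ‖y j‖ ^ 2) * ‖b (y j) (P2.empirical y)‖ ^ 2 ≤ A * (R ^ (2 * κ - 2) * R ^ 6) ∧
      (hsNorm (σ (y j) (P2.empirical y)) ^ 2) ^ 2 ≤ A * (R ^ (2 * κ - 2) * R ^ 6) := by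
  set L₂ := ‖b 0 (P2.dirac 0)‖ with hL₂
  have hL₁ := hlip.pos
  have ha₂ := hcoer.nonneg
  have hC := hcoer.C_nonneg
  have hκ : 0 ≤ 2 * κ - 2 := by linarith [hlip.one_le]
  set D : ℝ := 2 * L₂ ^ 2 + 8 * L₁ with hD
  have hD0 : 0 ≤ D := by positivity
  refine ⟨1 + 8 * D + 2 * (a₂ + C) ^ 2, ?_, ?_⟩
  · have : 0 ≤ 8 * D + 2 * (a₂ + C) ^ 2 := by positivity
    linarith
  intro N _ y R hR hy j
  have hR0 : 0 ≤ R := by linarith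
  set Q := R ^ (2 * κ - 2) with hQ
  have hQ1 : 1 ≤ Q := Real.one_le_rpow hR hκ
  set μ := P2.empirical y with hμ
  have hyR : ‖y j‖ ^ 2 ≤ R ^ 2 := pow_le_pow_left₀ (norm_nonneg _) (hy j) 2
  have hmean : (N : ℝ)⁻¹ * ∑ i, ‖y i‖ ^ 2 ≤ R ^ 2 :=
    natCast_inv_mul_sum_le fun i => pow_le_pow_left₀ (norm_nonneg _) (hy i) 2
  have hR2 : 1 ≤ R ^ 2 := one_le_pow₀ hR
  have hQR : 1 ≤ Q * R ^ 2 := one_le_mul_of_one_le_of_one_le hQ1 hR2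
  have hb : ‖b (y j) μ‖ ^ 2 ≤ D * (Q * R ^ 2) := by
    have h1 := hlip.bound (y j) 0 μ (P2.dirac 0)
    have h2 : ‖b (y j) μ - b 0 (P2.dirac 0)‖ ^ 2 ≤ L₁ * ((1 + Q + 1) * R ^ 2 + R ^ 2) := by
      refine h1.trans ?_
      rw [sub_zero, norm_zero]
      have h3 : ‖y j‖ ^ (2 * κ - 2) ≤ Q := Real.rpow_le_rpow (norm_nonneg _) (hy j) hκ
      have h4 : (0 : ℝ) ^ (2 * κ - 2) ≤ 1 := Real.zero_rpow_le_one _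
      have h5 := (P2.sq_W2_empirical_dirac_zero_le y).trans hmean
      have h6 : 0 ≤ (0 : ℝ) ^ (2 * κ - 2) := Real.rpow_nonneg le_rfl _
      gcongr
    have h7 : ‖b (y j) μ‖ ≤ ‖b (y j) μ - b 0 (P2.dirac 0)‖ + L₂ := by
      have := norm_add_le (b (y j) μ - b 0 (P2.dirac 0)) (b 0 (P2.dirac 0))
      rwa [sub_add_cancel] at this
    have h8 := pow_le_pow_left₀ (norm_nonneg _) h7 2
    have h9 := add_sq_le (a := ‖b (y j) μ - b 0 (P2.dirac 0)‖) (b := L₂)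
    have h10 : (1 + Q + 1) * R ^ 2 + R ^ 2 ≤ 4 * (Q * R ^ 2) := by
      linarith [mul_le_mul_of_nonneg_right hQ1 (sq_nonneg R)]
    have h11 := mul_le_mul_of_nonneg_left h10 hL₁.le
    have h12 := mul_le_mul_of_nonneg_left hQR (sq_nonneg L₂)
    rw [hD]
    linarith
  have hpow : Q * R ^ 4 ≤ Q * R ^ 6 := by gcongr; linarith
  have hDQ : D * (Q * R ^ 4) ≤ D * (Q * R ^ 6) := by gcongr
  have hQ6 : 0 ≤ Q * R ^ 6 := by positivity
  have hyb : ‖y j‖ ^ 2 * ‖b (y j) μ‖ ^ 2 ≤ D * (Q * R ^ 4) := by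
    calc ‖y j‖ ^ 2 * ‖b (y j) μ‖ ^ 2 ≤ R ^ 2 * (D * (Q * R ^ 2)) := by gcongr
      _ = D * (Q * R ^ 4) := by ring
  have hrest : 0 ≤ (1 + 2 * (a₂ + C) ^ 2) * (Q * R ^ 6) := by positivity
  have hDQ0 : 0 ≤ D * (Q * R ^ 6) := by positivity
  constructor
  · have h1 : Q * R ^ 2 ≤ Q * R ^ 6 := by gcongr; linarith
    have h2 : D * (Q * R ^ 2) ≤ D * (Q * R ^ 6) := by gcongr
    linarith
  · have h1 := hcoer.bound (y j) μ
    have h2 : hsNorm (σ (y j) μ) ^ 2 ≤ 2 * (‖y j‖ * ‖b (y j) μ‖) + (a₂ + C) * R ^ 2 := by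
      have h3 := neg_le_of_abs_le (abs_real_inner_le_norm (y j) (b (y j) μ))
      have h4 : hsNorm (σ (y j) μ) ^ 2 ≤ (qs - 1) * hsNorm (σ (y j) μ) ^ 2 :=
        le_mul_of_one_le_left (sq_nonneg _) (by linarith)
      have h5 : P2.norm2 μ ^ 2 ≤ R ^ 2 := (P2.sq_norm2_empirical y).trans_le hmean
      have h6 := mul_le_mul_of_nonneg_left h5 ha₂
      have h7 := mul_le_mul_of_nonneg_left hR2 hC
      have h8 : 0 ≤ a₁ * ‖y j‖ ^ 2 := mul_nonneg (ha₂.trans hcoer.lt.le) (sq_nonneg _)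
      linarith
    have h3 := pow_le_pow_left₀ (sq_nonneg _) h2 2
    have h4 := add_sq_le (a := 2 * (‖y j‖ * ‖b (y j) μ‖)) (b := (a₂ + C) * R ^ 2)
    have h5 : (R ^ 2) ^ 2 ≤ Q * R ^ 6 := by
      calc (R ^ 2) ^ 2 = 1 * R ^ 4 := by ring
        _ ≤ Q * R ^ 6 := by gcongr; linarith
    have h6 := mul_le_mul_of_nonneg_left h5 (sq_nonneg (a₂ + C))
    rw [mul_pow, mul_pow, mul_pow (a₂ + C)] at h4
    linarith

/-! ### Gaussian increments -/

section Gaussian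

lemma integral_pow_gaussianReal (v : ℝ≥0) (k : ℕ) :
    ∫ x, x ^ (2 * k) ∂gaussianReal 0 v = (v : ℝ) ^ k * ∫ x, x ^ (2 * k) ∂gaussianReal 0 1 := by
  have h : gaussianReal 0 v = (gaussianReal 0 1).map (√v * ·) := by
    rw [gaussianReal_map_const_mul]
    congr 1
    · simp
    · ext; simp
  rw [h, integral_map (by fun_prop) (by fun_prop), ← integral_const_mul]
  refine integral_congr_ae (ae_of_all _ fun x => ?_)
  beta_reduce
  rw [mul_pow, pow_mul √(v : ℝ), Real.sq_sqrt v.coe_nonneg]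

lemma integrable_pow_gaussianReal (v : ℝ≥0) (k : ℕ) :
    Integrable (fun x => x ^ k) (gaussianReal 0 v) := by
  have := (memLp_id_gaussianReal (μ := 0) (v := v) k).integrable_norm_pow'
  refine this.mono (by fun_prop) (ae_of_all _ fun x => by simp)

variable {Ω : Type*} [MeasurableSpace Ω] {P : Measure Ω} {d m : ℕ}
  {G : Ω → Vec m} {h : ℝ≥0}

lemma sq_norm_pow_succ_le_sum (g : Vec m) (k : ℕ) :
    (‖g‖ ^ 2) ^ (k + 1) ≤ (m : ℝ) ^ k * ∑ c, g c ^ (2 * (k + 1)) := by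
  rw [EuclideanSpace.real_norm_sq_eq]
  rcases Nat.eq_zero_or_pos m with rfl | hm
  · simp
  have := pow_sum_div_card_le_sum_pow (s := Finset.univ) (f := fun c => g c ^ 2)
    (fun c _ => sq_nonneg _) k
  rw [Finset.card_univ, Fintype.card_fin, div_le_iff₀ (by positivity), mul_comm] at this
  simpa only [pow_mul] using this

/-- The even moments of an increment scale as powers of the step. -/
lemma exists_moment_bound (m k : ℕ) : ∃ c : ℝ, 0 ≤ c ∧ ∀ {Ω : Type*} [MeasurableSpace Ω]
    {P : Measure Ω} {G : Ω → Vec m} {h : ℝ≥0}, Measurable G →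
    (∀ c, HasLaw (fun ω => G ω c) (gaussianReal 0 h) P) →
    Integrable (fun ω => (‖G ω‖ ^ 2) ^ (k + 1)) P ∧
      ∫ ω, (‖G ω‖ ^ 2) ^ (k + 1) ∂P ≤ c * (h : ℝ) ^ (k + 1) := by
  refine ⟨(m : ℝ) ^ k * (m * ∫ x, x ^ (2 * (k + 1)) ∂gaussianReal 0 1), ?_, ?_⟩
  · have : 0 ≤ ∫ x, x ^ (2 * (k + 1)) ∂gaussianReal 0 1 :=
      integral_nonneg fun x => by rw [pow_mul]; positivity
    positivity
  intro Ω _ P G h hG hlaw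
  have hint : ∀ c, Integrable (fun ω => G ω c ^ (2 * (k + 1))) P := fun c => by
    have := integrable_pow_gaussianReal h (2 * (k + 1))
    rw [← (hlaw c).map_eq] at this
    exact this.comp_aemeasurable (hlaw c).aemeasurable
  have hsum : Integrable (fun ω => (m : ℝ) ^ k * ∑ c, G ω c ^ (2 * (k + 1))) P :=
    (integrable_finsetSum _ fun c _ => hint c).const_mul _
  have hI : Integrable (fun ω => (‖G ω‖ ^ 2) ^ (k + 1)) P := by
    refine hsum.mono' (by fun_prop) (ae_of_all _ fun ω => ?_)
    rw [Real.norm_of_nonneg (by positivity)]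
    exact sq_norm_pow_succ_le_sum _ _
  refine ⟨hI, (integral_mono hI hsum fun ω => sq_norm_pow_succ_le_sum _ _).trans (le_of_eq ?_)⟩
  have hval : ∀ c, ∫ ω, G ω c ^ (2 * (k + 1)) ∂P
      = (h : ℝ) ^ (k + 1) * ∫ x, x ^ (2 * (k + 1)) ∂gaussianReal 0 1 := fun c => by
    rw [← integral_pow_gaussianReal, ← (hlaw c).map_eq, integral_map (hlaw c).aemeasurable
      (by fun_prop)]
  rw [integral_const_mul, integral_finsetSum _ fun c _ => hint c]
  simp only [hval, Finset.sum_const, Finset.card_univ, Fintype.card_fin, nsmul_eq_mul]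
  ring

lemma integrable_coord (hlaw : ∀ c, HasLaw (fun ω => G ω c) (gaussianReal 0 h) P) (c : Fin m) :
    Integrable (fun ω => G ω c) P := by
  have := integrable_pow_gaussianReal h 1
  rw [← (hlaw c).map_eq] at this
  simpa [Function.comp_def] using this.comp_aemeasurable (hlaw c).aemeasurable

lemma integral_coord (hlaw : ∀ c, HasLaw (fun ω => G ω c) (gaussianReal 0 h) P) (c : Fin m) :
    ∫ ω, G ω c ∂P = 0 := by
  rw [(hlaw c).integral_eq, integral_id_gaussianReal]

lemma memLp_two_coord (hlaw : ∀ c, HasLaw (fun ω => G ω c) (gaussianReal 0 h) P) (c : Fin m) :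
    MemLp (fun ω => G ω c) 2 P := by
  have := memLp_id_gaussianReal (μ := 0) (v := h) 2
  rw [← (hlaw c).map_eq] at this
  exact this.comp_of_map (hlaw c).aemeasurable

lemma inner_mulVec (B : Matrix (Fin d) (Fin m) ℝ) (v : Vec d) (g : Vec m) :
    inner ℝ v (WithLp.toLp 2 (B.mulVec g.ofLp)) = ∑ i, ∑ c, v i * B i c * g c := by
  simp only [PiLp.inner_apply, Matrix.mulVec, dotProduct, RCLike.inner_apply, conj_trivial,
    Finset.sum_mul]
  exact Finset.sum_congr rfl fun i _ => Finset.sum_congr rfl fun c _ => by ring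

lemma integrable_inner_mulVec (hlaw : ∀ c, HasLaw (fun ω => G ω c) (gaussianReal 0 h) P)
    (B : Matrix (Fin d) (Fin m) ℝ) (v : Vec d) :
    Integrable (fun ω => inner ℝ v (WithLp.toLp 2 (B.mulVec (G ω).ofLp))) P := by
  simp only [inner_mulVec]
  exact integrable_finsetSum _ fun i _ => integrable_finsetSum _ fun c _ =>
    (integrable_coord hlaw c).const_mul _

lemma integral_inner_mulVec (hlaw : ∀ c, HasLaw (fun ω => G ω c) (gaussianReal 0 h) P)
    (B : Matrix (Fin d) (Fin m) ℝ) (v : Vec d) :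
    ∫ ω, inner ℝ v (WithLp.toLp 2 (B.mulVec (G ω).ofLp)) ∂P = 0 := by
  simp only [inner_mulVec]
  rw [integral_finsetSum _ fun i _ => integrable_finsetSum _ fun c _ =>
    (integrable_coord hlaw c).const_mul _]
  refine Finset.sum_eq_zero fun i _ => ?_
  rw [integral_finsetSum _ fun c _ => (integrable_coord hlaw c).const_mul _]
  refine Finset.sum_eq_zero fun c _ => ?_
  rw [integral_const_mul, integral_coord hlaw, mul_zero]

/-- Itô's isometry over one step. -/
lemma integral_sq_norm_mulVec [IsProbabilityMeasure P]
    (hlaw : ∀ c, HasLaw (fun ω => G ω c) (gaussianReal 0 h) P)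
    (hind : iIndepFun (fun c ω => G ω c) P) (B : Matrix (Fin d) (Fin m) ℝ) :
    ∫ ω, ‖WithLp.toLp 2 (B.mulVec (G ω).ofLp)‖ ^ 2 ∂P = h * hsNorm B ^ 2 := by
  have hL : ∀ i c, MemLp (fun ω => B i c * G ω c) 2 P := fun i c =>
    (memLp_two_coord hlaw c).const_mul _
  have hS : ∀ i, MemLp (fun ω => ∑ c, B i c * G ω c) 2 P := fun i =>
    memLp_finsetSum _ fun c _ => hL i c
  simp only [sq_norm_mulVec]
  rw [integral_finsetSum _ fun i _ => (hS i).integrable_sq, sq_hsNorm, Finset.mul_sum]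
  refine Finset.sum_congr rfl fun i _ => ?_
  have h0 : ∫ ω, ∑ c, B i c * G ω c ∂P = 0 := by
    rw [integral_finsetSum _ fun c _ => (integrable_coord hlaw c).const_mul _]
    exact Finset.sum_eq_zero fun c _ => by rw [integral_const_mul, integral_coord hlaw, mul_zero]
  rw [← variance_of_integral_eq_zero (hS i).aestronglyMeasurable.aemeasurable h0]
  have hsum : (fun ω => ∑ c, B i c * G ω c) = ∑ c, fun ω => B i c * G ω c := by
    ext ω; simp
  rw [hsum, IndepFun.variance_sum (fun c _ => hL i c)]
  · rw [Finset.mul_sum]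
    refine Finset.sum_congr rfl fun c _ => ?_
    rw [variance_const_mul, (hlaw c).variance_eq, variance_id_gaussianReal]
    ring
  · intro c _ c' _ hcc'
    exact (hind.indepFun hcc').comp (measurable_const_mul (B i c)) (measurable_const_mul (B i c'))

end Gaussian

/-! ### One step of the scheme from a deterministic state -/

/-- Conditional moment bound: one step from a deterministic state, with the drift and diffusion
coefficients frozen at values `v`, `B` tamed at the scale `h`. -/
lemma exists_integral_step_le {n : ℕ} (hn : 2 ≤ n) (d m : ℕ) {A : ℝ} (hA : 1 ≤ A) :
    ∃ c : ℝ, 0 ≤ c ∧ ∀ {Ω : Type*} [MeasurableSpace Ω] {P : Measure Ω} [IsProbabilityMeasure P]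
      {G : Ω → Vec m} {h : ℝ≥0}, Measurable G →
      (∀ c, HasLaw (fun ω => G ω c) (gaussianReal 0 h) P) → iIndepFun (fun c ω => G ω c) P →
      0 < h → (h : ℝ) ≤ 1 → ∀ (y v : Vec d) (B : Matrix (Fin d) (Fin m) ℝ),
      (h : ℝ) * ((1 + ‖y‖ ^ 2) * ‖v‖ ^ 2) ≤ A → (h : ℝ) * (hsNorm B ^ 2) ^ 2 ≤ A →
      Integrable
        (fun ω => (1 + ‖y + (h : ℝ) • v + WithLp.toLp 2 (B.mulVec (G ω).ofLp)‖ ^ 2) ^ n) P ∧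
      ∫ ω, (1 + ‖y + (h : ℝ) • v + WithLp.toLp 2 (B.mulVec (G ω).ofLp)‖ ^ 2) ^ n ∂P ≤
        (1 + ‖y‖ ^ 2) ^ n + n * (1 + ‖y‖ ^ 2) ^ (n - 1) *
          (h * (2 * inner ℝ y v + (1 + 6 * n) * hsNorm B ^ 2 + c)) := by
  obtain ⟨c, hc0, hc⟩ := exists_one_add_sq_norm_pow_le hn hA
  choose M hM0 hM using fun k => exists_moment_bound m k
  refine ⟨c * (1 + (M 1 + M (n - 1) + M (2 * n - 1)) * A ^ (2 * n)), ?_, ?_⟩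
  · have := hM0 1
    have := hM0 (n - 1)
    have := hM0 (2 * n - 1)
    positivity
  intro Ω _ P _ G h hG hlaw hind hh hh1 y v B hyv hB
  have hh' : (0 : ℝ) < h := hh
  set Z : Ω → Vec d := fun ω => WithLp.toLp 2 (B.mulVec (G ω).ofLp) with hZ
  have hZm : Measurable Z := by
    have : Continuous fun g : Vec m => (WithLp.toLp 2 (B.mulVec g.ofLp) : Vec d) := by fun_prop
    exact this.measurable.comp hG
  set S : ℝ := h * hsNorm B ^ 2 with hS
  have hS0 : 0 ≤ S := by positivity
  have hS2 : S ^ 2 ≤ A * h := by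
    rw [hS]
    have := mul_le_mul_of_nonneg_right hB hh'.le
    linarith
  have hSA : S ≤ A := by
    refine abs_le_of_sq_le_sq' ?_ (by linarith) |>.2
    nlinarith
  have hSk : ∀ k, 2 ≤ k → k ≤ 2 * n → S ^ k ≤ A ^ (2 * n) * h := fun k hk hk' => by
    calc S ^ k = S ^ (k - 2) * S ^ 2 := by rw [← pow_add]; congr 1; omega
      _ ≤ A ^ (k - 2) * (A * h) := by gcongr
      _ = A ^ (k - 1) * h := by rw [← mul_assoc, ← pow_succ]; congr 2; omega
      _ ≤ A ^ (2 * n) * h := by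
        have := pow_le_pow_right₀ hA (by omega : k - 1 ≤ 2 * n)
        gcongr
  have hpt : ∀ ω k, (‖Z ω‖ ^ 2) ^ k ≤ (hsNorm B ^ 2) ^ k * (‖G ω‖ ^ 2) ^ k := fun ω k => by
    rw [← mul_pow]
    exact pow_le_pow_left₀ (sq_nonneg _) (sq_norm_mulVec_le B (G ω)) k
  have hint : ∀ k, 1 ≤ k → Integrable (fun ω => (‖Z ω‖ ^ 2) ^ k) P := fun k hk => by
    obtain ⟨k, rfl⟩ := Nat.exists_eq_add_of_le' hk
    refine ((hM k hG hlaw).1.const_mul ((hsNorm B ^ 2) ^ (k + 1))).mono' (by fun_prop)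
      (ae_of_all _ fun ω => ?_)
    rw [Real.norm_of_nonneg (by positivity)]
    exact hpt ω _
  have hmom : ∀ k, 2 ≤ k → k ≤ 2 * n →
      ∫ ω, (‖Z ω‖ ^ 2) ^ k ∂P ≤ M (k - 1) * A ^ (2 * n) * h := fun k hk hk' => by
    have hk1 : k - 1 + 1 = k := by omega
    have h1 := hM (k - 1) hG hlaw
    rw [hk1] at h1
    calc ∫ ω, (‖Z ω‖ ^ 2) ^ k ∂P ≤ ∫ ω, (hsNorm B ^ 2) ^ k * (‖G ω‖ ^ 2) ^ k ∂P :=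
          integral_mono (hint k (by omega)) (h1.1.const_mul _) fun ω => hpt ω k
      _ = (hsNorm B ^ 2) ^ k * ∫ ω, (‖G ω‖ ^ 2) ^ k ∂P := integral_const_mul _ _
      _ ≤ (hsNorm B ^ 2) ^ k * (M (k - 1) * (h : ℝ) ^ k) := by gcongr; exact h1.2
      _ = M (k - 1) * S ^ k := by rw [hS, mul_pow]; ring
      _ ≤ M (k - 1) * (A ^ (2 * n) * h) := mul_le_mul_of_nonneg_left (hSk k hk hk') (hM0 _)
      _ = _ := by ring
  have hlin : Integrable (fun ω => inner ℝ (y + (h : ℝ) • v) (Z ω)) P :=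
    integrable_inner_mulVec hlaw B _
  have hsq : Integrable (fun ω => ‖Z ω‖ ^ 2) P := by simpa using hint 1 le_rfl
  have hlin0 : ∫ ω, inner ℝ (y + (h : ℝ) • v) (Z ω) ∂P = 0 := integral_inner_mulVec hlaw B _
  have hsqS : ∫ ω, ‖Z ω‖ ^ 2 ∂P = S := integral_sq_norm_mulVec hlaw hind B
  set u := (1 + ‖y‖ ^ 2) with hu
  have hu0 : 0 ≤ n * u ^ (n - 1) := by positivity
  set g : Ω → ℝ := fun ω => 2 * h * inner ℝ y v + 2 * inner ℝ (y + (h : ℝ) • v) (Z ω)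
    + (1 + 6 * n) * ‖Z ω‖ ^ 2
    + c * (h + (‖Z ω‖ ^ 2) ^ 2 + (‖Z ω‖ ^ 2) ^ n + (‖Z ω‖ ^ 2) ^ (2 * n)) with hg
  have i1 : Integrable (fun ω => 2 * h * inner ℝ y v
      + 2 * inner ℝ (y + (h : ℝ) • v) (Z ω)) P := (integrable_const _).add (hlin.const_mul _)
  have i2 : Integrable (fun ω => (1 + 6 * (n : ℝ)) * ‖Z ω‖ ^ 2) P := hsq.const_mul _
  have i12 : Integrable (fun ω => 2 * h * inner ℝ y v + 2 * inner ℝ (y + (h : ℝ) • v) (Z ω)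
      + (1 + 6 * (n : ℝ)) * ‖Z ω‖ ^ 2) P := i1.add i2
  have i3 : Integrable (fun ω => (h : ℝ) + (‖Z ω‖ ^ 2) ^ 2) P :=
    (integrable_const _).add (hint 2 (by omega))
  have i4 : Integrable (fun ω => (h : ℝ) + (‖Z ω‖ ^ 2) ^ 2 + (‖Z ω‖ ^ 2) ^ n) P :=
    i3.add (hint n (by omega))
  have i5 : Integrable (fun ω => (h : ℝ) + (‖Z ω‖ ^ 2) ^ 2 + (‖Z ω‖ ^ 2) ^ n
      + (‖Z ω‖ ^ 2) ^ (2 * n)) P := i4.add (hint (2 * n) (by omega))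
  have hgint : Integrable g P := i12.add (i5.const_mul _)
  have hgval : ∫ ω, g ω ∂P = 2 * h * inner ℝ y v + (1 + 6 * n) * S
      + c * (h + ∫ ω, (‖Z ω‖ ^ 2) ^ 2 ∂P + ∫ ω, (‖Z ω‖ ^ 2) ^ n ∂P
        + ∫ ω, (‖Z ω‖ ^ 2) ^ (2 * n) ∂P) := by
    simp only [hg]
    rw [integral_add i12 (i5.const_mul _), integral_add i1 i2,
      integral_add (integrable_const _) (hlin.const_mul _), integral_const_mul, integral_const_mul,
      integral_const_mul, integral_const_mul, integral_add i4 (hint (2 * n) (by omega)),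
      integral_add i3 (hint n (by omega)), integral_add (integrable_const _) (hint 2 (by omega)),
      hlin0, hsqS]
    simp
  have hle : ∀ ω, (1 + ‖y + (h : ℝ) • v + Z ω‖ ^ 2) ^ n ≤ u ^ n + n * u ^ (n - 1) * g ω :=
    fun ω => hc (Vec d) y v (Z ω) h hh' hh1 hyv
  have hR : Integrable (fun ω => u ^ n + n * u ^ (n - 1) * g ω) P :=
    (integrable_const _).add (hgint.const_mul _)
  have hI : Integrable (fun ω => (1 + ‖y + (h : ℝ) • v + Z ω‖ ^ 2) ^ n) P := by
    refine hR.mono' (by fun_prop) (ae_of_all _ fun ω => ?_)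
    rw [Real.norm_of_nonneg (by positivity)]
    exact hle ω
  refine ⟨hI, (integral_mono hI hR hle).trans ?_⟩
  rw [integral_add (integrable_const _) (hgint.const_mul _), integral_const_mul, hgval]
  simp only [integral_const, probReal_univ, one_smul]
  gcongr
  have m2 := hmom 2 le_rfl (by omega)
  have mn := hmom n hn (by omega)
  have m2n := hmom (2 * n) (by omega) le_rfl
  have hc' := mul_le_mul_of_nonneg_left
    (add_le_add (add_le_add (add_le_add_right m2 (h : ℝ)) mn) m2n) hc0
  refine (add_le_add_right hc' _).trans (le_of_eq ?_)
  rw [hS]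
  ring

lemma nat_mul_pow_mul_le {n : ℕ} (hn : 1 ≤ n) {x y : ℝ} (hx : 0 < x) (hy : 0 ≤ y) :
    n * (x ^ (n - 1) * y) ≤ (n - 1) * x ^ n + y ^ n := by
  have h := one_add_mul_le_pow (a := y / x - 1) (by have := div_nonneg hy hx.le; linarith) n
  have h2 := mul_le_mul_of_nonneg_left h (pow_nonneg hx.le n)
  rw [← mul_pow, add_sub_cancel, mul_div_cancel₀ _ hx.ne'] at h2
  have h3 : x ^ n * (y / x) = x ^ (n - 1) * y := by
    obtain ⟨k, rfl⟩ := Nat.exists_eq_add_of_le' hn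
    rw [Nat.add_sub_cancel, pow_succ]; field_simp
  have h4 : x ^ n * (1 + n * (y / x - 1)) = n * (x ^ n * (y / x)) - (n - 1) * x ^ n := by ring
  rw [h4, h3] at h2
  linarith

lemma mul_pow_pred_le {n : ℕ} (hn : 1 ≤ n) {D ε x : ℝ} (hD : 0 ≤ D) (hε : 0 < ε) (hx : 0 ≤ x) :
    D * x ^ (n - 1) ≤ ε * x ^ n + D * (D / ε) ^ (n - 1) := by
  rcases le_total x (D / ε) with h | h
  · have := pow_le_pow_left₀ hx h (n - 1)
    have := mul_le_mul_of_nonneg_left this hD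
    have : 0 ≤ ε * x ^ n := by positivity
    linarith
  · rw [div_le_iff₀ hε] at h
    have h1 : D * x ^ (n - 1) ≤ ε * x ^ n := by
      calc D * x ^ (n - 1) ≤ x * ε * x ^ (n - 1) := by gcongr
        _ = ε * (x ^ (n - 1) * x) := by ring
        _ = ε * x ^ n := by rw [← pow_succ]; congr 2; omega
    have : 0 ≤ D * (D / ε) ^ (n - 1) := by positivity
    linarith

/-- One step of the interacting scheme from a deterministic configuration: coercivity makes the
own moment decay at rate `a₁`, while the empirical measure feeds back at the smaller rate `a₂`. -/
lemma exists_integral_euler_step_le {d m : ℕ} {b : Vec d → P2 d → Vec d}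
    {σ : Vec d → P2 d → Matrix (Fin d) (Fin m) ℝ} {L₁ κ q₀ a₁ a₂ qs C : ℝ}
    (hlip : PolyLipschitz b L₁ κ) (hcoer : Coercive b σ q₀ a₁ a₂ qs C)
    {n : ℕ} (hn : 2 ≤ n) (hqs : 6 * n + 2 ≤ qs) :
    ∃ c : ℝ, 0 ≤ c ∧ ∀ {Ω : Type*} [MeasurableSpace Ω] {P : Measure Ω} [IsProbabilityMeasure P]
      {G : Ω → Vec m} {h : ℝ≥0}, Measurable G →
      (∀ c, HasLaw (fun ω => G ω c) (gaussianReal 0 h) P) → iIndepFun (fun c ω => G ω c) P →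
      0 < h → (h : ℝ) ≤ 1 → ∀ (N : ℕ) [NeZero N] (y : Fin N → Vec d),
      (∀ i, ‖y i‖ ≤ (h : ℝ) ^ (-(1 / (2 * (κ + 2))))) → ∀ j,
      Integrable (fun ω => (1 + ‖y j + (h : ℝ) • b (y j) (P2.empirical y)
        + WithLp.toLp 2 ((σ (y j) (P2.empirical y)).mulVec (G ω).ofLp)‖ ^ 2) ^ n) P ∧
      ∫ ω, (1 + ‖y j + (h : ℝ) • b (y j) (P2.empirical y)
        + WithLp.toLp 2 ((σ (y j) (P2.empirical y)).mulVec (G ω).ofLp)‖ ^ 2) ^ n ∂P ≤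
        (1 - a₁ * h) * (1 + ‖y j‖ ^ 2) ^ n
          + h * (a₂ * ((N : ℝ)⁻¹ * ∑ i, (1 + ‖y i‖ ^ 2) ^ n) + c) := by
  have hn1 : (2 : ℝ) ≤ n := by exact_mod_cast hn
  obtain ⟨A, hA, hcoef⟩ := exists_coefficient_bound hlip hcoer (by linarith)
  obtain ⟨c, hc0, hc⟩ := exists_integral_step_le hn d m hA
  have ha₂ := hcoer.nonneg
  have ha := hcoer.lt
  have hC := hcoer.C_nonneg
  set D : ℝ := n * (a₁ + C + c) with hD
  have hD0 : 0 ≤ D := by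
    have : 0 ≤ a₁ + C + c := by linarith
    positivity
  have hε : 0 < a₁ - a₂ := by linarith
  refine ⟨D * (D / (a₁ - a₂)) ^ (n - 1), by positivity, ?_⟩
  intro Ω _ P _ G h hG hlaw hind hh hh1 N _ y hy j
  have hh' : (0 : ℝ) < h := hh
  obtain ⟨hb, hσ⟩ := hcoef N y _ (one_le_radius hlip.one_le hh' hh1) hy j
  rw [radius_rpow hlip.one_le hh', ← div_eq_mul_inv, le_div_iff₀' hh'] at hb hσ
  obtain ⟨hI, hle⟩ := hc hG hlaw hind hh hh1 (y j) (b (y j) (P2.empirical y))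
    (σ (y j) (P2.empirical y)) hb hσ
  refine ⟨hI, hle.trans ?_⟩
  have hco := hcoer.bound (y j) (P2.empirical y)
  rw [P2.sq_norm2_empirical] at hco
  have hs0 : 0 ≤ hsNorm (σ (y j) (P2.empirical y)) ^ 2 := sq_nonneg _
  have hN : (N : ℝ) ≠ 0 := Nat.cast_ne_zero.2 (NeZero.ne N)
  set u := 1 + ‖y j‖ ^ 2 with hu
  have hu0 : 0 < u := by positivity
  set U := (N : ℝ)⁻¹ * ∑ i, (1 + ‖y i‖ ^ 2) with hU
  have hU0 : 0 ≤ U := by positivity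
  have hUeq : (N : ℝ)⁻¹ * ∑ i, ‖y i‖ ^ 2 = U - 1 := by
    rw [hU, Finset.sum_add_distrib]
    simp [mul_add, hN]
  have hUn : U ^ n ≤ (N : ℝ)⁻¹ * ∑ i, (1 + ‖y i‖ ^ 2) ^ n := by
    have := Real.pow_arith_mean_le_arith_mean_pow Finset.univ (fun _ : Fin N => (N : ℝ)⁻¹)
      (fun i => 1 + ‖y i‖ ^ 2) (fun _ _ => by positivity) (by simp [hN])
      (fun i _ => by positivity) n
    simpa only [hU, ← Finset.mul_sum] using this
  set F := (N : ℝ)⁻¹ * ∑ i, (1 + ‖y i‖ ^ 2) ^ n with hF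
  have h1 : 2 * inner ℝ (y j) (b (y j) (P2.empirical y))
      + (1 + 6 * n) * hsNorm (σ (y j) (P2.empirical y)) ^ 2 + c
      ≤ -a₁ * u + a₂ * U + (a₁ + C + c) := by
    have e1 : (1 + 6 * (n : ℝ)) * hsNorm (σ (y j) (P2.empirical y)) ^ 2
        ≤ (qs - 1) * hsNorm (σ (y j) (P2.empirical y)) ^ 2 := by gcongr; linarith
    rw [hUeq] at hco
    rw [hu]
    linarith
  have hu1 : 0 ≤ n * u ^ (n - 1) := by positivity
  have h2 := mul_le_mul_of_nonneg_left (mul_le_mul_of_nonneg_left h1 hh'.le) hu1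
  have hpow : u ^ (n - 1) * u = u ^ n := by rw [← pow_succ]; congr 1; omega
  have h3 : n * u ^ (n - 1) * (h * (-a₁ * u + a₂ * U + (a₁ + C + c)))
      = h * (-(n * a₁) * u ^ n + a₂ * (n * (u ^ (n - 1) * U)) + D * u ^ (n - 1)) := by
    rw [← hpow, hD]; ring
  rw [h3] at h2
  have h4 := mul_le_mul_of_nonneg_left
    ((nat_mul_pow_mul_le (by omega) hu0 hU0).trans (add_le_add_right hUn _)) ha₂
  have h5 := mul_pow_pred_le (n := n) (by omega) hD0 hε hu0.le
  have hun : 0 ≤ u ^ n := by positivity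
  have h6 : -(n * a₁) * u ^ n + a₂ * (n * (u ^ (n - 1) * U)) + D * u ^ (n - 1)
      ≤ -a₁ * u ^ n + a₂ * F + D * (D / (a₁ - a₂)) ^ (n - 1) := by
    have h7 : 0 ≤ (n - 2) * ((a₁ - a₂) * u ^ n) :=
      mul_nonneg (by linarith) (mul_nonneg hε.le hun)
    linarith
  have h8 := mul_le_mul_of_nonneg_left h6 hh'.le
  linarith

/-! ### Independence of the increments from the past -/

section Independence

variable {Ω : Type*} [MeasurableSpace Ω] {P : Measure Ω}

/-- If the pairs `(A i, B i)` are independent in `i`, and `A i` is independent of `B i` for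
each `i`, then the families `A` and `B` are independent. -/
lemma indepFun_pi_of_iIndepFun_prodMk {ι α β : Type*} [Fintype ι] [MeasurableSpace α]
    [MeasurableSpace β] {A : ι → Ω → α} {B : ι → Ω → β} (hA : ∀ i, Measurable (A i))
    (hB : ∀ i, Measurable (B i)) (h : iIndepFun (fun i ω => (A i ω, B i ω)) P)
    (hAB : ∀ i, IndepFun (A i) (B i) P) :
    IndepFun (fun ω i => A i ω) (fun ω i => B i ω) P := by
  have := h.isProbabilityMeasure
  have hpA : ∀ i, IsProbabilityMeasure (P.map (A i)) := fun i =>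
    Measure.isProbabilityMeasure_map (hA i).aemeasurable
  have hpB : ∀ i, IsProbabilityMeasure (P.map (B i)) := fun i =>
    Measure.isProbabilityMeasure_map (hB i).aemeasurable
  have hA' : Measurable fun ω i => A i ω := measurable_pi_lambda _ hA
  have hB' : Measurable fun ω i => B i ω := measurable_pi_lambda _ hB
  have hAB' : Measurable fun ω i => (A i ω, B i ω) :=
    measurable_pi_lambda _ fun i => (hA i).prodMk (hB i)
  rw [indepFun_iff_map_prod_eq_prod_map_map hA'.aemeasurable hB'.aemeasurable,
    (h.comp (fun _ => Prod.fst) fun _ => measurable_fst).map_fun_eq_pi_map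
      fun i => (hA i).aemeasurable,
    (h.comp (fun _ => Prod.snd) fun _ => measurable_snd).map_fun_eq_pi_map
      fun i => (hB i).aemeasurable,
    ← (measurePreserving_arrowProdEquivProdArrow α β ι (fun i => P.map (A i))
      fun i => P.map (B i)).map_eq]
  have hpi : Measure.pi (fun i => (P.map (A i)).prod (P.map (B i)))
      = P.map fun ω i => (A i ω, B i ω) := by
    rw [h.map_fun_eq_pi_map fun i => ((hA i).prodMk (hB i)).aemeasurable]
    congr 1
    ext1 i
    exact ((indepFun_iff_map_prod_eq_prod_map_map (hA i).aemeasurable (hB i).aemeasurable).1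
      (hAB i)).symm
  rw [hpi, Measure.map_map (MeasurableEquiv.measurable _) hAB']
  rfl

lemma indepFun_prodMk_left [IsProbabilityMeasure P] {α β γ : Type*} [MeasurableSpace α]
    [MeasurableSpace β] [MeasurableSpace γ] {X : Ω → α} {A : Ω → β} {B : Ω → γ}
    (hX : Measurable X) (hA : Measurable A) (hB : Measurable B)
    (hXAB : IndepFun X (fun ω => (A ω, B ω)) P) (hAB : IndepFun A B P) :
    IndepFun (fun ω => (X ω, A ω)) B P := by
  have hXA : IndepFun X A P := hXAB.comp measurable_id measurable_fst
  have hpX : IsProbabilityMeasure (P.map X) := Measure.isProbabilityMeasure_map hX.aemeasurable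
  have hpA : IsProbabilityMeasure (P.map A) := Measure.isProbabilityMeasure_map hA.aemeasurable
  have hpB : IsProbabilityMeasure (P.map B) := Measure.isProbabilityMeasure_map hB.aemeasurable
  rw [indepFun_iff_map_prod_eq_prod_map_map (hX.prodMk hA).aemeasurable hB.aemeasurable,
    (indepFun_iff_map_prod_eq_prod_map_map hX.aemeasurable hA.aemeasurable).1 hXA]
  apply (MeasurableEquiv.prodAssoc (α := α) (β := β) (γ := γ)).map_measurableEquiv_injective
  rw [Measure.prodAssoc_prod,
    ← (indepFun_iff_map_prod_eq_prod_map_map hA.aemeasurable hB.aemeasurable).1 hAB,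
    ← (indepFun_iff_map_prod_eq_prod_map_map hX.aemeasurable
      (hA.prodMk hB).aemeasurable).1 hXAB,
    Measure.map_map (MeasurableEquiv.measurable _) ((hX.prodMk hA).prodMk hB)]
  rfl

namespace IsWiener

variable {m : ℕ} {W : ℝ≥0 → Ω → Vec m}

lemma measurable_coord (hW : IsWiener W P) (t : ℝ≥0) (c : Fin m) :
    Measurable fun ω => W t ω c := by
  have := hW.measurable t
  fun_prop

lemma hasLaw_increment (hW : IsWiener W P) (t h : ℝ≥0) (c : Fin m) :
    HasLaw (fun ω => (W (t + h) ω - W t ω) c) (gaussianReal 0 h) P := by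
  have := (hW.brownian c).toIsPreBrownianReal.hasLaw_sub (t + h) t
  have hdist : nndist (t + h).1 t.1 = h := by
    ext
    simp
  rw [hdist] at this
  exact this

lemma iIndepFun_increment (hW : IsWiener W P) (t h : ℝ≥0) :
    iIndepFun (fun c ω => (W (t + h) ω - W t ω) c) P :=
  hW.indep.comp (fun _ w => w (t + h) - w t) fun _ => by fun_prop

/-- The increment after time `t` is independent of the path up to time `t`. -/
lemma indepFun_past_increment (hW : IsWiener W P) (t h : ℝ≥0) :
    IndepFun (fun ω c (s : Set.Iic t) => W s ω c) (fun ω => W (t + h) ω - W t ω) P := by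
  have hcoord := indepFun_pi_of_iIndepFun_prodMk (P := P)
    (A := fun (c : Fin m) ω (s : Set.Iic t) => W s ω c)
    (B := fun c ω => W (t + h) ω c - W t ω c)
    (fun c => measurable_pi_lambda _ fun s => hW.measurable_coord s c)
    (fun c => (hW.measurable_coord _ c).sub (hW.measurable_coord _ c))
    (hW.indep.comp (fun _ w => ((fun s : Set.Iic t => w s), w (t + h) - w t))
      fun _ => by fun_prop)
    (fun c => ((hW.brownian c).toIsPreBrownianReal.indepFun_shift t).symm.comp
      measurable_id (measurable_pi_apply h))
  exact hcoord.comp (φ := id) (ψ := fun g => (WithLp.toLp 2 g : Vec m)) measurable_id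
    (by fun_prop)

end IsWiener

/-- The initial data and the paths of all particles up to time `t`. -/
def particlePast {d m N : ℕ} (W : Fin N → ℝ≥0 → Ω → Vec m) (X : Fin N → Ω → Vec d) (t : ℝ≥0)
    (ω : Ω) : Fin N → Vec d × (Fin m → Set.Iic t → ℝ) :=
  fun i => (X i ω, fun c s => W i s ω c)

namespace IsIIDCopies

variable {d m N : ℕ} {W : ℝ≥0 → Ω → Vec m} {X : Ω → Vec d} {Wc : Fin N → ℝ≥0 → Ω → Vec m}
  {Xc : Fin N → Ω → Vec d}

lemma measurable_path (hc : IsIIDCopies W X Wc Xc P) (t : ℝ≥0) (i : Fin N) :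
    Measurable fun ω (c : Fin m) (s : Set.Iic t) => Wc i s ω c :=
  measurable_pi_lambda _ fun c => measurable_pi_lambda _ fun s =>
    (hc.wiener i).measurable_coord s c

lemma measurable_particlePast (hc : IsIIDCopies W X Wc Xc P) (t : ℝ≥0) :
    Measurable (particlePast Wc Xc t) :=
  measurable_pi_lambda _ fun i => (hc.measurable i).prodMk (hc.measurable_path t i)

lemma indepFun_past_increment [IsProbabilityMeasure P] (hc : IsIIDCopies W X Wc Xc P)
    (hXW : IndepFun X (fun ω (t : ℝ≥0) => W t ω) P) (t h : ℝ≥0) (j : Fin N) :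
    IndepFun (particlePast Wc Xc t) (fun ω => Wc j (t + h) ω - Wc j t ω) P := by
  have hinc : ∀ i, Measurable fun ω => Wc i (t + h) ω - Wc i t ω := fun i =>
    ((hc.wiener i).measurable _).sub ((hc.wiener i).measurable _)
  have hXW' : ∀ i, IndepFun (Xc i) (fun ω (t : ℝ≥0) => Wc i t ω) P := fun i =>
    (indepFun_of_identDistrib_pair hXW.symm (hc.ident i).symm).symm
  have hpath : Measurable fun (w : ℝ≥0 → Vec m) =>
      ((fun (c : Fin m) (s : Set.Iic t) => w s c), w (t + h) - w t) := by
    fun_prop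
  have hpair := indepFun_pi_of_iIndepFun_prodMk (P := P)
    (A := fun i ω => (Xc i ω, fun (c : Fin m) (s : Set.Iic t) => Wc i s ω c))
    (B := fun i ω => Wc i (t + h) ω - Wc i t ω)
    (fun i => (hc.measurable i).prodMk (hc.measurable_path t i)) hinc
    (hc.indep.comp (fun _ z => ((z.2, fun (c : Fin m) (s : Set.Iic t) => z.1 s c),
      z.1 (t + h) - z.1 t)) fun _ => by fun_prop)
    (fun i => indepFun_prodMk_left (hc.measurable i) (hc.measurable_path t i) (hinc i)
      ((hXW' i).comp measurable_id hpath) ((hc.wiener i).indepFun_past_increment t h))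
  exact hpair.comp measurable_id (measurable_pi_apply j)

end IsIIDCopies

/-- Freezing an independent variable: a bound on the expectation for each fixed value of `U`
integrates to a bound for random `U`. -/
lemma integral_comp_le_of_indepFun [IsProbabilityMeasure P] {α β : Type*} [MeasurableSpace α]
    [MeasurableSpace β] {U : Ω → α} {V : Ω → β} (hU : Measurable U) (hV : Measurable V)
    (hind : IndepFun U V P) {F : α × β → ℝ} (hF : Measurable F) (hF0 : ∀ z, 0 ≤ F z)
    {r : α → ℝ} (hr : Integrable (fun ω => r (U ω)) P) (hrm : Measurable r)
    (hle : ∀ y, Integrable (fun ω => F (y, V ω)) P ∧ ∫ ω, F (y, V ω) ∂P ≤ r y) :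
    Integrable (fun ω => F (U ω, V ω)) P ∧ ∫ ω, F (U ω, V ω) ∂P ≤ ∫ ω, r (U ω) ∂P := by
  have hr0 : ∀ y, 0 ≤ r y := fun y => (integral_nonneg fun _ => hF0 _).trans (hle y).2
  have key : ∫⁻ ω, ENNReal.ofReal (F (U ω, V ω)) ∂P ≤ ∫⁻ ω, ENNReal.ofReal (r (U ω)) ∂P := by
    have hFm : Measurable fun z => ENNReal.ofReal (F z) := hF.ennreal_ofReal
    have hpV : IsProbabilityMeasure (P.map V) := Measure.isProbabilityMeasure_map hV.aemeasurable
    have hpU : IsProbabilityMeasure (P.map U) := Measure.isProbabilityMeasure_map hU.aemeasurable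
    rw [← lintegral_map (f := fun z => ENNReal.ofReal (F z)) hFm (hU.prodMk hV),
      (indepFun_iff_map_prod_eq_prod_map_map hU.aemeasurable hV.aemeasurable).1 hind,
      lintegral_prod _ hFm.aemeasurable,
      ← lintegral_map (f := fun y => ENNReal.ofReal (r y)) hrm.ennreal_ofReal hU]
    refine lintegral_mono fun y => ?_
    rw [lintegral_map (f := fun g => ENNReal.ofReal (F (y, g)))
        (hFm.comp measurable_prodMk_left) hV,
      ← ofReal_integral_eq_lintegral_ofReal (hle y).1 (ae_of_all _ fun _ => hF0 _)]
    exact ENNReal.ofReal_le_ofReal (hle y).2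
  have hFUV : Measurable fun ω => F (U ω, V ω) := hF.comp (hU.prodMk hV)
  have hfin : ∫⁻ ω, ENNReal.ofReal (r (U ω)) ∂P < ∞ := by
    rw [← ofReal_integral_eq_lintegral_ofReal hr (ae_of_all _ fun _ => hr0 _)]
    exact ENNReal.ofReal_lt_top
  have hint : Integrable (fun ω => F (U ω, V ω)) P :=
    ⟨hFUV.aestronglyMeasurable, by
      rw [hasFiniteIntegral_iff_ofReal (ae_of_all _ fun _ => hF0 _)]
      exact key.trans_lt hfin⟩
  refine ⟨hint, ?_⟩
  rw [integral_eq_lintegral_of_nonneg_ae (ae_of_all _ fun _ => hF0 _) hFUV.aestronglyMeasurable,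
    integral_eq_lintegral_of_nonneg_ae (ae_of_all _ fun _ => hr0 _)
      hr.aestronglyMeasurable]
  exact ENNReal.toReal_mono hfin.ne key

end Independence

/-! ### The projected Euler scheme as a function of the noise -/

section Scheme

variable {d m N : ℕ} [NeZero N] {b : Vec d → P2 d → Vec d}
  {σ : Vec d → P2 d → Matrix (Fin d) (Fin m) ℝ} {K₁ K₂ L₁ κ q₀ a₁ a₂ qs C : ℝ}

/-- The Euler step of particle `j` from an already projected configuration `y`, driven by the
increment `g` of that particle. -/
noncomputable def eulerStep (b : Vec d → P2 d → Vec d)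
    (σ : Vec d → P2 d → Matrix (Fin d) (Fin m) ℝ) (h : ℝ) (j : Fin N) (y : Fin N → Vec d)
    (g : Vec m) : Vec d :=
  y j + h • b (y j) (P2.empirical y)
    + WithLp.toLp 2 ((σ (y j) (P2.empirical y)).mulVec g.ofLp)

lemma measurable_eulerStep (hmono : ContractiveMonotone b σ K₁ K₂) (hlip : PolyLipschitz b L₁ κ)
    (h : ℝ) (j : Fin N) :
    Measurable fun z : (Fin N → Vec d) × Vec m => eulerStep b σ h j z.1 z.2 := by
  have hb : Continuous fun z : (Fin N → Vec d) × Vec m => b (z.1 j) (P2.empirical z.1) :=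
    (hlip.continuous_drift j).comp continuous_fst
  have hσ : Continuous fun z : (Fin N → Vec d) × Vec m => σ (z.1 j) (P2.empirical z.1) :=
    (hmono.continuous_diffusion hlip j).comp continuous_fst
  have hg : Continuous fun z : (Fin N → Vec d) × Vec m => z.2.ofLp := by fun_prop
  have hσg : Continuous fun z : (Fin N → Vec d) × Vec m =>
      (WithLp.toLp 2 ((σ (z.1 j) (P2.empirical z.1)).mulVec z.2.ofLp) : Vec d) :=
    (PiLp.continuous_toLp 2 _).comp (hσ.matrix_mulVec hg)
  have hy : Continuous fun z : (Fin N → Vec d) × Vec m => z.1 j := by fun_prop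
  have hsum : Continuous fun z : (Fin N → Vec d) × Vec m => eulerStep b σ h j z.1 z.2 :=
    (hy.add (hb.const_smul h)).add hσg
  exact hsum.measurable

variable {Ω : Type*} {W : Fin N → ℝ≥0 → Ω → Vec m} {X : Fin N → Ω → Vec d} {h : ℝ≥0}

lemma projectedEuler_succ (k : ℕ) (j : Fin N) (ω : Ω) :
    projectedEuler b σ κ h W X (k + 1) j ω =
      eulerStep b σ h j (fun i => proj κ h (projectedEuler b σ κ h W X k i ω))
        (W j ((k : ℝ≥0) * h + h) ω - W j ((k : ℝ≥0) * h) ω) := by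
  have : ((k + 1 : ℕ) : ℝ≥0) * h = (k : ℝ≥0) * h + h := by push_cast; ring
  rw [← this]
  rfl

/-- The iterates up to step `k` are measurable functions of the data up to any time
`t ≥ k h`. -/
lemma exists_projectedEuler_eq (hmono : ContractiveMonotone b σ K₁ K₂)
    (hlip : PolyLipschitz b L₁ κ) (k : ℕ) (t : ℝ≥0) (ht : (k : ℝ≥0) * h ≤ t) :
    ∃ Φ : (Fin N → Vec d × (Fin m → Set.Iic t → ℝ)) → Fin N → Vec d, Measurable Φ ∧
      ∀ ω j, projectedEuler b σ κ h W X k j ω = Φ (particlePast W X t ω) j := by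
  induction k with
  | zero => exact ⟨fun x j => (x j).1, by fun_prop, fun ω j => rfl⟩
  | succ k ih =>
    have ht1 : (k : ℝ≥0) * h + h ≤ t := by
      refine le_trans (le_of_eq ?_) ht
      push_cast; ring
    have ht0 : (k : ℝ≥0) * h ≤ t := le_self_add.trans ht1
    obtain ⟨Φ, hΦ, hΦe⟩ := ih ht0
    refine ⟨fun x j => eulerStep b σ h j (fun i => proj κ h (Φ x i))
      (WithLp.toLp 2 fun c => (x j).2 c ⟨(k : ℝ≥0) * h + h, ht1⟩
        - (x j).2 c ⟨(k : ℝ≥0) * h, ht0⟩), ?_, fun ω j => ?_⟩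
    · refine measurable_pi_lambda _ fun j => ?_
      have hy : Measurable fun x i => proj κ h (Φ x i) :=
        measurable_pi_lambda _ fun i => measurable_proj.comp ((measurable_pi_apply i).comp hΦ)
      have hg : Measurable fun x : Fin N → Vec d × (Fin m → Set.Iic t → ℝ) =>
          (WithLp.toLp 2 fun c => (x j).2 c ⟨(k : ℝ≥0) * h + h, ht1⟩
            - (x j).2 c ⟨(k : ℝ≥0) * h, ht0⟩ : Vec m) := by
        fun_prop
      exact (measurable_eulerStep hmono hlip h j).comp (hy.prodMk hg)
    · rw [projectedEuler_succ]
      simp only [hΦe]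
      rfl

end Scheme

/-! ### Discrete Gronwall argument -/

lemma le_of_contractive_recursion {x : ℕ → ℝ} {θ c h : ℝ} (hθ : 0 < θ) (hc : 0 ≤ c) (hh : 0 < h)
    (hh1 : h ≤ 1) (hx : ∀ k, 0 ≤ x k) (hrec : ∀ k, x (k + 1) ≤ (1 - θ * h) * x k + h * c)
    (k : ℕ) : x k ≤ x 0 + (c / θ + c) := by
  have hcθ : 0 ≤ c / θ := by positivity
  induction k with
  | zero => linarith
  | succ k ih =>
    refine (hrec k).trans ?_
    rcases le_total (θ * h) 1 with h1 | h1
    · have h2 := mul_le_mul_of_nonneg_left ih (sub_nonneg.2 h1)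
      have h3 : h * c ≤ θ * h * (x 0 + (c / θ + c)) := by
        have h4 : θ * h * (c / θ) = h * c := by field_simp
        have h5 : 0 ≤ θ * h * (x 0 + c) := by have := hx 0; positivity
        linarith
      linarith
    · have h2 : (1 - θ * h) * x k ≤ 0 := mul_nonpos_of_nonpos_of_nonneg (by linarith) (hx k)
      have h3 : h * c ≤ c := mul_le_of_le_one_left hc hh1
      linarith [hx 0]

/-- The contraction is first applied to the average over the particles, where the feedback through
the empirical measure costs only `a₂ < a₁`; the resulting bound on the average makes the feedback
a constant in the recursion for a single particle. -/
lemma interacting_recursion_le {N : ℕ} [NeZero N] {e E : ℕ → Fin N → ℝ} {a₁ a₂ c h M : ℝ}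
    (ha₂ : 0 ≤ a₂) (ha : a₂ < a₁) (hc : 0 ≤ c) (hh : 0 < h) (hh1 : h ≤ 1) (hM : 1 ≤ M)
    (he : ∀ k j, 0 ≤ e k j) (heE : ∀ k j, e k j ≤ E k j) (h0 : ∀ j, E 0 j ≤ M)
    (hrec : ∀ k j, E (k + 1) j ≤
      (1 - a₁ * h) * e k j + h * (a₂ * ((N : ℝ)⁻¹ * ∑ i, e k i) + c)) (k : ℕ) (j : Fin N) :
    E k j ≤ (1 + ((a₂ * (1 + (c / (a₁ - a₂) + c)) + c) / a₁
      + 2 * (a₂ * (1 + (c / (a₁ - a₂) + c)) + c))) * M := by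
  have ha₁ : 0 < a₁ := by linarith
  have hε : 0 < a₁ - a₂ := by linarith
  have hN : (N : ℝ) ≠ 0 := Nat.cast_ne_zero.2 (NeZero.ne N)
  set D := c / (a₁ - a₂) + c with hD
  have hD0 : 0 ≤ D := by positivity
  have hmean : ∀ k, (N : ℝ)⁻¹ * ∑ i, e k i ≤ M + D := fun k => by
    refine (le_of_contractive_recursion (x := fun k => (N : ℝ)⁻¹ * ∑ i, e k i) hε hc hh hh1
      (fun k => ?_) (fun k => ?_) k).trans ?_
    · have : 0 ≤ ∑ i, e k i := Finset.sum_nonneg fun i _ => he k i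
      positivity
    · set S := (N : ℝ)⁻¹ * ∑ i, e k i with hS
      have h1 : (N : ℝ)⁻¹ * ∑ i, e (k + 1) i
          ≤ (N : ℝ)⁻¹ * ∑ i, ((1 - a₁ * h) * e k i + h * (a₂ * S + c)) := by
        gcongr with i
        exact (heE _ _).trans (hrec k i)
      rw [Finset.sum_add_distrib, ← Finset.mul_sum, mul_add, mul_left_comm, ← hS] at h1
      simp only [Finset.sum_const, Finset.card_univ, Fintype.card_fin, nsmul_eq_mul,
        inv_mul_cancel_left₀ hN] at h1
      linarith
    · have : (N : ℝ)⁻¹ * ∑ i, e 0 i ≤ M :=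
        natCast_inv_mul_sum_le fun i => (heE 0 i).trans (h0 i)
      linarith
  set c₂ := a₂ * (1 + D) + c with hc₂
  have hc₂0 : 0 ≤ c₂ := by positivity
  have hrec' : ∀ k j, E (k + 1) j ≤ (1 - a₁ * h) * e k j + h * (c₂ * M) := fun k j => by
    refine (hrec k j).trans ?_
    have h1 := mul_le_mul_of_nonneg_left (hmean k) ha₂
    have h2 : a₂ * (M + D) + c ≤ c₂ * M := by
      have : 0 ≤ (a₂ * D + c) * (M - 1) := mul_nonneg (by positivity) (by linarith)
      rw [hc₂]; linarith
    gcongr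
    linarith
  have hcM : 0 ≤ c₂ * M := by positivity
  have hej : ∀ k, e k j ≤ M + (c₂ * M / a₁ + c₂ * M) := fun k =>
    (le_of_contractive_recursion (x := fun k => e k j) ha₁ hcM hh hh1 (fun k => he k j)
      (fun k => (heE _ _).trans (hrec' k j)) k).trans (by linarith [heE 0 j, h0 j])
  have hdiv : c₂ * M / a₁ = c₂ / a₁ * M := by ring
  have hdiv0 : 0 ≤ c₂ / a₁ * M := by positivity
  rcases k with _ | k
  · linarith [h0 j]
  · have h1 := hrec' k j
    have h2 := hej k
    have h3 : h * (c₂ * M) ≤ c₂ * M := mul_le_of_le_one_left hcM hh1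
    have h4 : 0 ≤ a₁ * h * e k j := mul_nonneg (by positivity) (he k j)
    linarith

/-! ### Moment bounds for the scheme -/

lemma exists_moment_bound_projectedEuler {d m : ℕ} {b : Vec d → P2 d → Vec d}
    {σ : Vec d → P2 d → Matrix (Fin d) (Fin m) ℝ} {K₁ K₂ L₁ κ q₀ a₁ a₂ qs C : ℝ}
    (hmono : ContractiveMonotone b σ K₁ K₂) (hlip : PolyLipschitz b L₁ κ)
    (hcoer : Coercive b σ q₀ a₁ a₂ qs C) {n : ℕ} (hn : 2 ≤ n) (hqs : 6 * n + 2 ≤ qs) :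
    ∃ K : ℝ, 0 < K ∧ ∀ {Ω : Type*} [MeasurableSpace Ω] {P : Measure Ω} [IsProbabilityMeasure P]
      {W : ℝ≥0 → Ω → Vec m} {X : Ω → Vec d} {N : ℕ} [NeZero N] {Wc : Fin N → ℝ≥0 → Ω → Vec m}
      {Xc : Fin N → Ω → Vec d}, IndepFun X (fun ω (t : ℝ≥0) => W t ω) P →
      IsIIDCopies W X Wc Xc P → ∀ {h : ℝ≥0}, 0 < h → (h : ℝ) ≤ 1 → ∀ {M : ℝ}, 1 ≤ M →
      (∀ j, Integrable (fun ω => (1 + ‖Xc j ω‖ ^ 2) ^ n) P) →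
      (∀ j, ∫ ω, (1 + ‖Xc j ω‖ ^ 2) ^ n ∂P ≤ M) → ∀ k j,
      Measurable (projectedEuler b σ κ h Wc Xc k j) ∧
      Integrable (fun ω => (1 + ‖projectedEuler b σ κ h Wc Xc k j ω‖ ^ 2) ^ n) P ∧
      ∫ ω, (1 + ‖projectedEuler b σ κ h Wc Xc k j ω‖ ^ 2) ^ n ∂P ≤ K * M := by
  obtain ⟨c, hc0, hc⟩ := exists_integral_euler_step_le hlip hcoer hn hqs
  have ha₂ := hcoer.nonneg
  have ha := hcoer.lt
  have ha₁ : 0 < a₁ := by linarith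
  have hε : 0 < a₁ - a₂ := by linarith
  refine ⟨1 + ((a₂ * (1 + (c / (a₁ - a₂) + c)) + c) / a₁
      + 2 * (a₂ * (1 + (c / (a₁ - a₂) + c)) + c)), by positivity, ?_⟩
  intro Ω _ P _ W X N _ Wc Xc hXW hcop h hh hh1 M hM hX hXM
  have hh' : (0 : ℝ) < h := hh
  set Y := projectedEuler b σ κ h Wc Xc with hY
  have hmeas : ∀ k j, Measurable (Y k j) := fun k j => by
    obtain ⟨Φ, hΦ, hΦe⟩ := exists_projectedEuler_eq (κ := κ) (h := h) (W := Wc) (X := Xc)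
      hmono hlip k _ le_rfl
    have : Y k j = fun ω => Φ (particlePast Wc Xc (k * h) ω) j := funext fun ω => hΦe ω j
    rw [this]
    exact (measurable_pi_apply j).comp (hΦ.comp (hcop.measurable_particlePast _))
  have hproj_int : ∀ k j, Integrable (fun ω => (1 + ‖proj κ h (Y k j ω)‖ ^ 2) ^ n) P := by
    intro k j
    have hpm : Measurable fun ω => proj κ h (Y k j ω) := measurable_proj.comp (hmeas k j)
    have hfm : Measurable fun ω => (1 + ‖proj κ h (Y k j ω)‖ ^ 2) ^ n := by
      exact ((hpm.norm.pow_const 2).const_add 1).pow_const n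
    refine Integrable.of_bound hfm.aestronglyMeasurable
      ((1 + ((h : ℝ) ^ (-(1 / (2 * (κ + 2))))) ^ 2) ^ n) (ae_of_all _ fun ω => ?_)
    rw [Real.norm_of_nonneg (by positivity)]
    have := norm_proj_le_radius (κ := κ) hh'.le (Y k j ω)
    gcongr
  have hstep : ∀ k j, Integrable (fun ω => (1 + ‖Y (k + 1) j ω‖ ^ 2) ^ n) P ∧
      ∫ ω, (1 + ‖Y (k + 1) j ω‖ ^ 2) ^ n ∂P ≤
        (1 - a₁ * h) * ∫ ω, (1 + ‖proj κ h (Y k j ω)‖ ^ 2) ^ n ∂P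
          + h * (a₂ * ((N : ℝ)⁻¹ * ∑ i, ∫ ω, (1 + ‖proj κ h (Y k i ω)‖ ^ 2) ^ n ∂P) + c) := by
    intro k j
    set t : ℝ≥0 := k * h with ht
    obtain ⟨Φ, hΦ, hΦe⟩ := exists_projectedEuler_eq (κ := κ) (h := h) (W := Wc) (X := Xc)
      hmono hlip k t le_rfl
    set G : Ω → Vec m := fun ω => Wc j (t + h) ω - Wc j t ω with hG
    have hGm : Measurable G := ((hcop.wiener j).measurable _).sub ((hcop.wiener j).measurable _)
    set U : Ω → Fin N → Vec d := fun ω i => Y k i ω with hU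
    have hUm : Measurable U := measurable_pi_lambda _ fun i => hmeas k i
    have hind : IndepFun U G P := by
      have h1 := (hcop.indepFun_past_increment hXW t h j).comp hΦ measurable_id
      have h2 : U = Φ ∘ particlePast Wc Xc t := funext fun ω => funext fun i => hΦe ω i
      rw [h2]
      exact h1
    set pr : (Fin N → Vec d) → Fin N → Vec d := fun y i => proj κ h (y i) with hpr
    have hprm : Measurable pr :=
      measurable_pi_lambda _ fun i => measurable_proj.comp (measurable_pi_apply i)
    set r : (Fin N → Vec d) → ℝ := fun y => (1 - a₁ * h) * (1 + ‖pr y j‖ ^ 2) ^ n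
      + h * (a₂ * ((N : ℝ)⁻¹ * ∑ i, (1 + ‖pr y i‖ ^ 2) ^ n) + c) with hr
    have hrm : Measurable r := by
      have hi : ∀ i, Measurable fun y => (1 + ‖pr y i‖ ^ 2) ^ n := fun i => by
        have : Measurable fun y => pr y i := (measurable_pi_apply i).comp hprm
        fun_prop
      have hj := hi j
      have hs : Measurable fun y => ∑ i, (1 + ‖pr y i‖ ^ 2) ^ n :=
        Finset.measurable_sum _ fun i _ => hi i
      rw [hr]
      exact (hj.const_mul _).add ((((hs.const_mul _).const_mul _).add_const _).const_mul _)
    have i1 : Integrable (fun ω => (1 - a₁ * h) * (1 + ‖pr (U ω) j‖ ^ 2) ^ n) P :=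
      (hproj_int k j).const_mul _
    have i2 : Integrable (fun ω => ∑ i, (1 + ‖pr (U ω) i‖ ^ 2) ^ n) P :=
      integrable_finsetSum _ fun i _ => hproj_int k i
    have i3 : Integrable (fun ω => a₂ * ((N : ℝ)⁻¹ * ∑ i, (1 + ‖pr (U ω) i‖ ^ 2) ^ n)) P :=
      (i2.const_mul _).const_mul _
    have i4 : Integrable (fun ω => (h : ℝ) * (a₂ * ((N : ℝ)⁻¹ *
        ∑ i, (1 + ‖pr (U ω) i‖ ^ 2) ^ n) + c)) P := (i3.add (integrable_const c)).const_mul _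
    have hrint : Integrable (fun ω => r (U ω)) P := i1.add i4
    have hrval : ∫ ω, r (U ω) ∂P = (1 - a₁ * h) * ∫ ω, (1 + ‖proj κ h (Y k j ω)‖ ^ 2) ^ n ∂P
          + h * (a₂ * ((N : ℝ)⁻¹ * ∑ i, ∫ ω, (1 + ‖proj κ h (Y k i ω)‖ ^ 2) ^ n ∂P) + c) := by
      simp only [hr]
      rw [integral_add i1 i4, integral_const_mul, integral_const_mul,
        integral_add i3 (integrable_const c), integral_const_mul, integral_const_mul,
        integral_finsetSum _ fun i _ => hproj_int k i]
      simp [hpr, hU]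
    have hF : Measurable fun z : (Fin N → Vec d) × Vec m =>
        (1 + ‖eulerStep b σ h j (pr z.1) z.2‖ ^ 2) ^ n := by
      have : Measurable fun z : (Fin N → Vec d) × Vec m => eulerStep b σ h j (pr z.1) z.2 :=
        (measurable_eulerStep hmono hlip h j).comp
          ((hprm.comp measurable_fst).prodMk measurable_snd)
      fun_prop
    have hmain := integral_comp_le_of_indepFun hUm hGm hind hF (fun z => by positivity) hrint hrm
      (fun y => hc hGm ((hcop.wiener j).hasLaw_increment t h)
        ((hcop.wiener j).iIndepFun_increment t h) hh hh1 N (pr y)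
        (fun i => norm_proj_le_radius hh'.le _) j)
    rw [hrval] at hmain
    simpa only [hY, projectedEuler_succ] using hmain
  have hint : ∀ k j, Integrable (fun ω => (1 + ‖Y k j ω‖ ^ 2) ^ n) P := fun k j => by
    rcases k with _ | k
    · exact hX j
    · exact (hstep k j).1
  intro k j
  refine ⟨hmeas k j, hint k j, ?_⟩
  exact interacting_recursion_le (e := fun k j => ∫ ω, (1 + ‖proj κ h (Y k j ω)‖ ^ 2) ^ n ∂P)
    (E := fun k j => ∫ ω, (1 + ‖Y k j ω‖ ^ 2) ^ n ∂P) ha₂ ha hc0 hh' hh1 hM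
    (fun k j => integral_nonneg fun ω => by positivity)
    (fun k j => integral_mono (hproj_int k j) (hint k j) fun ω => by
      have := norm_proj_le_norm (κ := κ) hh'.le (Y k j ω)
      beta_reduce
      gcongr)
    hXM (fun k j => (hstep k j).2) k j

lemma one_add_sq_pow_le {n : ℕ} {s r : ℝ} (hs : 0 ≤ s) (hr : (2 * n : ℝ) ≤ r) :
    (1 + s ^ 2) ^ n ≤ 2 ^ n * (1 + s ^ r) := by
  have hsr : 0 ≤ s ^ r := Real.rpow_nonneg hs r
  rcases le_total s 1 with h | h
  · have h1 : (1 + s ^ 2) ^ n ≤ 2 ^ n :=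
      pow_le_pow_left₀ (by positivity) (by linarith [pow_le_one₀ (n := 2) hs h]) n
    exact h1.trans (le_mul_of_one_le_right (by positivity) (by linarith))
  · have h1 : (1 + s ^ 2) ^ n ≤ (2 * s ^ 2) ^ n :=
      pow_le_pow_left₀ (by positivity) (by linarith [one_le_pow₀ (n := 2) h]) n
    have h2 : (s ^ 2) ^ n ≤ s ^ r := by
      rw [← pow_mul, ← Real.rpow_natCast]
      exact Real.rpow_le_rpow_of_exponent_le h (by push_cast; exact hr)
    rw [mul_pow] at h1
    refine h1.trans (mul_le_mul_of_nonneg_left (by linarith) (by positivity))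

lemma rpow_le_one_add_rpow {s r r' : ℝ} (hs : 0 ≤ s) (hr : 0 ≤ r) (h : r ≤ r') :
    s ^ r ≤ 1 + s ^ r' := by
  rcases le_total s 1 with h1 | h1
  · linarith [Real.rpow_le_one hs h1 hr, Real.rpow_nonneg hs r']
  · linarith [Real.rpow_le_rpow_of_exponent_le h1 h]

lemma rpow_two_mul_le {n : ℕ} {s p : ℝ} (hs : 0 ≤ s) (hp : 0 ≤ p) (hpn : p ≤ n) :
    s ^ (2 * p) ≤ (1 + s ^ 2) ^ n := by
  calc s ^ (2 * p) = (s ^ 2) ^ p := by rw [Real.rpow_mul hs, Real.rpow_two]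
    _ ≤ (1 + s ^ 2) ^ p := Real.rpow_le_rpow (by positivity) (by linarith) hp
    _ ≤ (1 + s ^ 2) ^ (n : ℝ) :=
      Real.rpow_le_rpow_of_exponent_le (by linarith [sq_nonneg s]) hpn
    _ = (1 + s ^ 2) ^ n := Real.rpow_natCast _ _

theorem mainTheorem9 {d m : ℕ}
    (b : Vec d → P2 d → Vec d) (σ : Vec d → P2 d → Matrix (Fin d) (Fin m) ℝ)
    (K₁ K₂ L₁ κ L₂ q₀ a₁ a₂ qs C : ℝ)
    (hmono : ContractiveMonotone b σ K₁ K₂)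
    (hlip : PolyLipschitz b L₁ κ)
    (hq₀ : 20 ≤ q₀) (hL₂ : 0 < L₂) (hb₀ : ‖b 0 (P2.dirac 0)‖ ≤ L₂)
    (hcoer : Coercive b σ q₀ a₁ a₂ qs C)
    (h₀ : ℝ) (hh₀ : 0 < h₀) (hh₀' : h₀ ≤ 1)
    (p : ℝ) (hp : 1 ≤ p) (hp' : p < (⌊q₀ / 2⌋ : ℤ)) :
    ∃ K₆ : ℝ, 0 < K₆ ∧
      ∀ (Ω : Type*) [MeasurableSpace Ω] (P : Measure Ω) [IsProbabilityMeasure P]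
        (W : ℝ≥0 → Ω → Vec m) (X₀ : Ω → Vec d),
        IsWiener W P → Measurable X₀ →
        IndepFun X₀ (fun ω (t : ℝ≥0) => W t ω) P →
        Integrable (fun ω => ‖X₀ ω‖ ^ (2 * q₀)) P →
      ∀ (N : ℕ) [NeZero N] (Wc : Fin N → ℝ≥0 → Ω → Vec m) (Xc : Fin N → Ω → Vec d),
        IsIIDCopies W X₀ Wc Xc P →
      ∀ h : ℝ≥0, 0 < h →
        (h : ℝ) ≤ min (min (1 / (2 * (K₁ - K₂))) h₀) (1 / (p * (a₁ - a₂))) →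
      Integrable (fun ω => 1 + ‖X₀ ω‖ ^ (4 * p)) P ∧
      (∀ j, Integrable (fun ω => 1 + ‖Xc j ω‖ ^ (4 * p)) P) ∧
      (⨆ j, ∫ ω, (1 + ‖Xc j ω‖ ^ (4 * p)) ∂P) = ∫ ω, (1 + ‖X₀ ω‖ ^ (4 * p)) ∂P ∧
      ∀ k : ℕ,
        (∀ j, Integrable (fun ω => ‖projectedEuler b σ κ h Wc Xc k j ω‖ ^ (2 * p)) P) ∧
        (⨆ j, ∫ ω, ‖projectedEuler b σ κ h Wc Xc k j ω‖ ^ (2 * p) ∂P)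
          ≤ K₆ * ⨆ j, ∫ ω, (1 + ‖Xc j ω‖ ^ (4 * p)) ∂P := by
  -- An even integer exponent `2 n` with `p ≤ n ≤ 2 p`, so that the `2 n`-th moment of the initial
  -- value is controlled by its `4 p`-th moment, and `n ≤ q₀ / 2`, as coercivity requires.
  obtain ⟨n, hn, hpn, hnp, hnq⟩ : ∃ n : ℕ, 2 ≤ n ∧ p ≤ n ∧ (n : ℝ) ≤ 2 * p ∧
      (n : ℝ) ≤ q₀ / 2 := by
    refine ⟨max 2 ⌈p⌉₊, le_max_left _ _, ?_, ?_, ?_⟩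
    · push_cast
      exact (Nat.le_ceil p).trans (le_max_right _ _)
    · push_cast
      exact max_le (by linarith) (by linarith [Nat.ceil_lt_add_one (by linarith : 0 ≤ p)])
    · push_cast
      refine max_le (by linarith) ?_
      have h1 : ⌈p⌉ ≤ ⌊q₀ / 2⌋ := Int.ceil_le.2 hp'.le
      have h2 : ((⌈p⌉₊ : ℕ) : ℝ) = ((⌈p⌉ : ℤ) : ℝ) := natCast_ceil_eq_intCast_ceil (by linarith)
      rw [h2]
      exact (Int.cast_le.2 h1).trans (Int.floor_le _)
  have hqs : 6 * n + 2 ≤ qs := by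
    have : (2 : ℝ) ≤ n := by exact_mod_cast hn
    linarith [hcoer.le_qs]
  obtain ⟨K, hK0, hK⟩ := exists_moment_bound_projectedEuler hmono hlip hcoer hn hqs
  refine ⟨K * 2 ^ n, by positivity, ?_⟩
  intro Ω _ P _ W X₀ hW hX₀ hXW hXint N _ Wc Xc hcop h hh hhle
  have hh1 : (h : ℝ) ≤ 1 :=
    (hhle.trans ((min_le_left _ _).trans (min_le_right _ _))).trans hh₀'
  have hp0 : 0 ≤ p := by linarith
  have h4p : 4 * p ≤ 2 * q₀ := by
    have : p ≤ q₀ / 2 := hp'.le.trans (Int.floor_le _)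
    linarith
  have hI₀ : Integrable (fun ω => 1 + ‖X₀ ω‖ ^ (4 * p)) P := by
    have hm : Measurable fun ω => ‖X₀ ω‖ ^ (4 * p) := hX₀.norm.pow_const _
    refine (integrable_const 1).add
      (((integrable_const 1).add hXint).mono' hm.aestronglyMeasurable (ae_of_all _ fun ω => ?_))
    rw [Real.norm_of_nonneg (by positivity)]
    exact rpow_le_one_add_rpow (norm_nonneg _) (by linarith) h4p
  have hid : ∀ j, IdentDistrib (fun ω => 1 + ‖Xc j ω‖ ^ (4 * p))
      (fun ω => 1 + ‖X₀ ω‖ ^ (4 * p)) P P := fun j =>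
    (hcop.ident j).comp (u := fun z : (ℝ≥0 → Vec m) × Vec d => 1 + ‖z.2‖ ^ (4 * p))
      ((measurable_snd.norm.pow_const _).const_add 1)
  have hIc : ∀ j, Integrable (fun ω => 1 + ‖Xc j ω‖ ^ (4 * p)) P := fun j =>
    (hid j).integrable_iff.2 hI₀
  have hsup : (⨆ j, ∫ ω, (1 + ‖Xc j ω‖ ^ (4 * p)) ∂P) = ∫ ω, (1 + ‖X₀ ω‖ ^ (4 * p)) ∂P := by
    simp only [fun j => (hid j).integral_eq]
    exact ciSup_const
  refine ⟨hI₀, hIc, hsup, fun k => ?_⟩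
  rw [hsup]
  set M₀ := ∫ ω, (1 + ‖X₀ ω‖ ^ (4 * p)) ∂P with hM₀
  have hM₀1 : 1 ≤ M₀ := by
    have := integral_mono (integrable_const (μ := P) (1 : ℝ)) hI₀ fun ω => by
      have : 0 ≤ ‖X₀ ω‖ ^ (4 * p) := by positivity
      beta_reduce
      linarith
    simpa using this
  have hM : 1 ≤ 2 ^ n * M₀ := one_le_mul_of_one_le_of_one_le (one_le_pow₀ (by norm_num)) hM₀1
  have hle : ∀ j ω, (1 + ‖Xc j ω‖ ^ 2) ^ n ≤ 2 ^ n * (1 + ‖Xc j ω‖ ^ (4 * p)) := fun j ω =>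
    one_add_sq_pow_le (norm_nonneg _) (by linarith)
  have hX : ∀ j, Integrable (fun ω => (1 + ‖Xc j ω‖ ^ 2) ^ n) P := fun j => by
    have := hcop.measurable j
    refine ((hIc j).const_mul (2 ^ n)).mono' (by fun_prop) (ae_of_all _ fun ω => ?_)
    rw [Real.norm_of_nonneg (by positivity)]
    exact hle j ω
  have hXM : ∀ j, ∫ ω, (1 + ‖Xc j ω‖ ^ 2) ^ n ∂P ≤ 2 ^ n * M₀ := fun j => by
    refine (integral_mono (hX j) ((hIc j).const_mul (2 ^ n)) (hle j)).trans (le_of_eq ?_)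
    rw [integral_const_mul, (hid j).integral_eq]
  have hmain := hK hXW hcop hh hh1 hM hX hXM k
  have hpt : ∀ j ω, ‖projectedEuler b σ κ h Wc Xc k j ω‖ ^ (2 * p)
      ≤ (1 + ‖projectedEuler b σ κ h Wc Xc k j ω‖ ^ 2) ^ n := fun j ω =>
    rpow_two_mul_le (norm_nonneg _) hp0 hpn
  have hint : ∀ j, Integrable (fun ω => ‖projectedEuler b σ κ h Wc Xc k j ω‖ ^ (2 * p)) P := by
    intro j
    have := (hmain j).1
    refine (hmain j).2.1.mono' (by fun_prop) (ae_of_all _ fun ω => ?_)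
    rw [Real.norm_of_nonneg (by positivity)]
    exact hpt j ω
  refine ⟨hint, ciSup_le fun j => ?_⟩
  rw [mul_assoc]
  exact (integral_mono (hint j) (hmain j).2.1 (hpt j)).trans (hmain j).2.2
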